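/- Let $q$ be a prime power, $n\ge 1$, and let $U=U_n(q)$ be the group of upper triangular $n\times n$ matrices over $\mathbb F_q$ with all diagonal entries $1$. The positive roots are $\alpha_{i,j}$, $0<i\le j<n$; $X_{\alpha_{i,j}}=\{I_n+c\,e_{i,j+1}:c\in\mathbb F_q\}$ is the root subgroup, and we say that $\alpha_{i,j}$ lies in row $i$ and column $j+1$. For $\alpha=\alpha_{i,j}$ let $\mathrm{arm}(\alpha)=\{\alpha_{i,l}: i\le l<j\}$, $\mathrm{leg}(\alpha)=\{\alpha_{k,j}: i<k\le j\}$, and let $$H(\alpha)=\langle X_\beta:\beta\in\{\alpha\}\cup \mathrm{arm}(\alpha)\cup \mathrm{leg}(\alpha)\rangle,\quad V_\alpha=\langle X_\beta:\beta\notin \mathrm{arm}(\alpha)\rangle,\quad U_\alpha=\langle X_{\alpha_{k,l}}: i\le k\le l\le j\rangle .$$ Let $\Lambda_\alpha$ be the set of linear characters $\lambda$ of $V_\alpha$ that are nontrivial on $X_\alpha$ and trivial on every other root subgroup contained in $V_\alpha$. A *basic set* is a nonempty set $D$ of positive roots no two of which lie in the same row or in the same column. For a basic set $D$ let $E_D$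 be the set of families $\phi=(\lambda_\alpha)_{\alpha\in D}$ with $\lambda_\alpha\in\Lambda_\alpha$, and let $\xi_{D,\phi}=\bigotimes_{\alpha\in D}\lambda_\alpha^U$, where $\lambda_\alpha^U$ is the character of $U$ induced from $\lambda_\alpha$. Let $\mathrm{Irr}(\xi)$ be the set of irreducible (complex) constituents of a character $\xi$ of $U$. **Lemma 3.6.** Let $D$ be a basic set which decomposes as $D=A\cup B$, that is, $A$ and $B$ are nonempty and disjoint, and for some positive root $\beta$ we have $\langle U_\alpha:\alpha\in A\rangle\subseteq U_\beta$ and $\langle H(\alpha):\alpha\in B\rangle\cap U_\beta=\{1\}$. Let $\phi\in E_D$, $\phi_A\in E_A$, $\phi_B\in E_B$ with $\phi=\phi_A\cup\phi_B$. Then $\chi_A\otimes\chi_B\in\mathrm{Irr}(\xi_{D,\phi})$ for all $\chi_A\in\mathrm{Irr}(\xi_{A,\phi_A})$ and $\chi_B\in\mathrm{Irr}(\xi_{B,\phi_B})$; for every $\chi\in\mathrm{Irr}(\xi_{D,\phi})$ there is exactly one pair $(\chi_A,\chi_B)\in\mathrm{Irr}(\xi_{A,\phi_A})\times\mathrm{Irr}(\xi_{B,\phi_B})$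 with $\chi=\chi_A\otimes\chi_B$; and $|\mathrm{Irr}(\xi_{D,\phi})|=|\mathrm{Irr}(\xi_{A,\phi_A})\times\mathrm{Irr}(\xi_{B,\phi_B})|$. -/

import Mathlib

noncomputable section

namespace UTri

/-! ### Class functions, irreducible characters, constituents, induction -/

section Characters

variable {G : Type*} [Group G]

/-- `Irr(G)`: the characters `G → ℂ` of the irreducible finite-dimensional complex
representations of `G` (each of which can be realised on some `ℂ ^ d`). -/
def IrrChar (G : Type*) [Group G] : Set (G → ℂ) :=
  {χ | ∃ (d : ℕ) (ρ : Representation ℂ G (Fin d → ℂ)), ρ.IsIrreducible ∧ ρ.character = χ}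

/-- The scalar product `(χ, ψ) = |G|⁻¹ ∑ χ(g) * conj ψ(g)` of complex functions on `G`. -/
def charInner [Fintype G] (χ ψ : G → ℂ) : ℂ :=
  (Fintype.card G : ℂ)⁻¹ * ∑ g, χ g * (starRingEnd ℂ) (ψ g)

/-- `Irr(ψ)`: the irreducible constituents of a character `ψ` of the finite group `G`. -/
def constituents [Fintype G] (ψ : G → ℂ) : Set (G → ℂ) :=
  {χ | χ ∈ IrrChar G ∧ charInner χ ψ ≠ 0}

open scoped Classical in
/-- The character `θ ^ G` of `G` induced from a function `θ` on a subgroup `H`: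
`θ ^ G (g) = |H|⁻¹ ∑ θ(x⁻¹ g x)`, the sum being over those `x ∈ G` with `x⁻¹ g x ∈ H`. -/
def inducedChar [Fintype G] (H : Subgroup G) (θ : H → ℂ) : G → ℂ := fun g =>
  (Nat.card H : ℂ)⁻¹ * ∑ x : G, if h : x⁻¹ * g * x ∈ H then θ ⟨x⁻¹ * g * x, h⟩ else 0

end Characters

/-! ### The group `U_n(F)` and its root subgroups -/

/-- `U_n(F)`: upper triangular invertible matrices with all diagonal entries equal to `1`. -/
def U (n : ℕ) (F : Type*) [Field F] : Subgroup (GL (Fin n) F) where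
  carrier := {g | (∀ i, (g : Matrix (Fin n) (Fin n) F) i i = 1) ∧
    ∀ i j, j < i → (g : Matrix (Fin n) (Fin n) F) i j = 0}
  one_mem' := ⟨fun i => by simp, fun i j h => by simp [Matrix.one_apply_ne h.ne']⟩
  mul_mem' := by
    rintro a b ⟨ha, ha'⟩ ⟨hb, hb'⟩
    refine ⟨fun i => ?_, fun i j hij => ?_⟩
    · rw [Units.val_mul, Matrix.mul_apply, Finset.sum_eq_single i]
      · rw [ha, hb, one_mul]
      · intro k _ hk
        rcases lt_or_gt_of_ne hk with h | h
        · rw [ha' i k h, zero_mul]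
        · rw [hb' k i h, mul_zero]
      · simp
    · rw [Units.val_mul, Matrix.mul_apply]
      refine Finset.sum_eq_zero fun k _ => ?_
      rcases lt_or_ge k i with h | h
      · rw [ha' i k h, zero_mul]
      · rw [hb' k j (hij.trans_le h), mul_zero]
  inv_mem' := by
    rintro a ⟨ha, ha'⟩
    have hT : (a : Matrix (Fin n) (Fin n) F).BlockTriangular id := fun i j h => ha' i j h
    let : Invertible (a : Matrix (Fin n) (Fin n) F) := a.invertible
    have hI := Matrix.blockTriangular_inv_of_blockTriangular hT
    rw [← Matrix.coe_units_inv] at hI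
    refine ⟨fun i => ?_, fun i j h => hI h⟩
    have h1 := congrFun (congrFun (a.mul_inv) i) i
    rw [Matrix.mul_apply, Finset.sum_eq_single i, ha, one_mul, Matrix.one_apply_eq] at h1
    · exact h1
    · intro k _ hk
      rcases lt_or_gt_of_ne hk with h | h
      · rw [ha' i k h, zero_mul]
      · rw [show (↑a⁻¹ : Matrix (Fin n) (Fin n) F) k i = 0 from hI h, mul_zero]
    · simp

instance instFintypeU (n : ℕ) (F : Type*) [Field F] [Finite F] : Fintype (U n F) :=
  haveI : Finite (GL (Fin n) F) := inferInstanceAs (Finite (Matrix (Fin n) (Fin n) F)ˣ)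
  Fintype.ofFinite _

/-- The positive roots of `GL_n`, each recorded by its matrix position: the root
`α_{i,j} = α_i + ⋯ + α_j` (`0 < i ≤ j < n`) is the position in row `i` and column `j + 1` (here
rows and columns are numbered from `0` instead of `1`). -/
@[ext]
structure PosRoot (n : ℕ) where
  row : Fin n
  col : Fin n
  lt : row < col

namespace PosRoot

variable {n : ℕ}

/-- The arm of `α_{i,j}` is `{α_{i,l} : i ≤ l < j}`. -/
def arm (α : PosRoot n) : Set (PosRoot n) := {β | β.row = α.row ∧ β.col < α.col}

/-- The leg of `α_{i,j}` is `{α_{k,j} : i < k ≤ j}`. -/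
def leg (α : PosRoot n) : Set (PosRoot n) := {β | β.col = α.col ∧ α.row < β.row}

/-- The hook at `α`. -/
def hook (α : PosRoot n) : Set (PosRoot n) := {α} ∪ α.arm ∪ α.leg

/-- Two roots are separate if they are on neither the same row nor the same column. -/
def Separate (α β : PosRoot n) : Prop := α.row ≠ β.row ∧ α.col ≠ β.col

/-- The roots `α_{k,l}` with `i ≤ k ≤ l ≤ j`, where `α = α_{i,j}`: the positive roots of the
subtriangle whose corner is `α` (including `α`). -/
def triangle (α : PosRoot n) : Set (PosRoot n) := {β | α.row ≤ β.row ∧ β.col ≤ α.col}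

end PosRoot

section Subgroups

variable {n : ℕ} (F : Type*) [Field F]

/-- The matrix `1 + c e_{ij}` as an invertible matrix, where `(i, j)` is the position of `α`. -/
def rootGL (α : PosRoot n) (c : F) : GL (Fin n) F where
  val := Matrix.transvection α.row α.col c
  inv := Matrix.transvection α.row α.col (-c)
  val_inv := by
    rw [Matrix.transvection_mul_transvection_same _ _ α.lt.ne, add_neg_cancel,
      Matrix.transvection_zero]
  inv_val := by
    rw [Matrix.transvection_mul_transvection_same _ _ α.lt.ne, neg_add_cancel,
      Matrix.transvection_zero]

/-- The element `x_α(c) = 1 + c e_{ij}` of `U_n(F)`, where `(i, j)` is the position of `α`. -/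
def rootElt (α : PosRoot n) (c : F) : U n F :=
  ⟨rootGL F α c, by
    have hlt := α.lt
    refine ⟨fun i => ?_, fun i j hij => ?_⟩
    · have h : ¬ (α.row = i ∧ α.col = i) := fun h => hlt.ne (h.1.trans h.2.symm)
      simp [rootGL, Matrix.transvection, Matrix.single_apply_of_ne, h]
    · have h : ¬ (α.row = i ∧ α.col = j) := fun h => by
        rw [h.1, h.2] at hlt
        exact lt_asymm hlt hij
      simp [rootGL, Matrix.transvection, Matrix.single_apply_of_ne, h,
        Matrix.one_apply_ne hij.ne']⟩

/-- The root subgroup `X_α = {1 + c e_{ij} : c ∈ F}`. -/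
def X (α : PosRoot n) : Subgroup (U n F) where
  carrier := Set.range (rootElt F α)
  one_mem' := ⟨0, Subtype.ext (Units.ext (Matrix.transvection_zero _ _))⟩
  mul_mem' := by
    rintro _ _ ⟨c, rfl⟩ ⟨d, rfl⟩
    exact ⟨c + d, Subtype.ext (Units.ext
      (Matrix.transvection_mul_transvection_same _ _ α.lt.ne c d).symm)⟩
  inv_mem' := by
    rintro _ ⟨c, rfl⟩
    exact ⟨-c, Subtype.ext (Units.ext rfl)⟩

/-- The hook group `H(α)`, generated by the root subgroups of the hook at `α`. -/
def hookGroup (α : PosRoot n) : Subgroup (U n F) := ⨆ β ∈ α.hook, X F β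

/-- The base group `V_α`, generated by the root subgroups outside the arm of `α`. -/
def baseGroup (α : PosRoot n) : Subgroup (U n F) := ⨆ β ∈ (α.arm)ᶜ, X F β

/-- The subtriangular group `U_α`, generated by the root subgroups of the subtriangle with
corner `α`. -/
def triGroup (α : PosRoot n) : Subgroup (U n F) := ⨆ β ∈ α.triangle, X F β

/-- The set `Irr(V_α / [V_α, V_α])^*`: the linear characters of `V_α` that are nontrivial on `X_α`
and trivial on every other root subgroup contained in `V_α`. -/
def LinChar (α : PosRoot n) : Type _ :=
  {l : baseGroup F α →* ℂˣ //
    (∃ v : baseGroup F α, (v : U n F) ∈ X F α ∧ l v ≠ 1) ∧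
    ∀ β : PosRoot n, β ≠ α → X F β ≤ baseGroup F α →
      ∀ v : baseGroup F α, (v : U n F) ∈ X F β → l v = 1}

variable {F}

/-- The elementary character `λ ^ U` at `α`. -/
def elementaryChar [Finite F] {α : PosRoot n} (l : LinChar F α) : U n F → ℂ :=
  inducedChar (baseGroup F α) (fun v => ((l.1 v : ℂˣ) : ℂ))

/-- A basic set: a nonempty set of pairwise separate positive roots. -/
def IsBasic (D : Finset (PosRoot n)) : Prop :=
  D.Nonempty ∧ ∀ α ∈ D, ∀ β ∈ D, α ≠ β → α.Separate β

variable (F) in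
/-- `E_D`: the families `(λ_α)_{α ∈ D}` with `λ_α ∈ Irr(V_α / [V_α, V_α])^*`. -/
abbrev CharFamily (D : Finset (PosRoot n)) : Type _ := (α : D) → LinChar F α.1

/-- The basic character `ξ_{D,φ}`, the (tensor) product of the elementary characters `λ_α ^ U`. -/
def basicChar [Finite F] (D : Finset (PosRoot n)) (φ : CharFamily F D) : U n F → ℂ :=
  ∏ α : D, elementaryChar (φ α)

variable (F) in
/-- `D` decomposes as `D = A ∪ B`: the sets `A` and `B` are nonempty and disjoint with union `D`,
and for some positive root `β`, the groups `U_α` with `α ∈ A` generate a subgroup of `U_β`, while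
the group generated by the `H(α)` with `α ∈ B` meets `U_β` trivially. -/
def DecomposesAs (D A B : Finset (PosRoot n)) : Prop :=
  A.Nonempty ∧ B.Nonempty ∧ Disjoint A B ∧ (∀ α, α ∈ D ↔ α ∈ A ∨ α ∈ B) ∧
    ∃ β : PosRoot n, (⨆ α ∈ A, triGroup F α) ≤ triGroup F β ∧
      (⨆ α ∈ B, hookGroup F α) ⊓ triGroup F β = ⊥

/-- `φ = φ_A ∪ φ_B`, for `D = A ∪ B`. -/
def IsUnionFamily {D A B : Finset (PosRoot n)} (φ : CharFamily F D)
    (φA : CharFamily F A) (φB : CharFamily F B) : Prop :=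
  (∀ α (hD : α ∈ D) (hA : α ∈ A), φ ⟨α, hD⟩ = φA ⟨α, hA⟩) ∧
  (∀ α (hD : α ∈ D) (hB : α ∈ B), φ ⟨α, hD⟩ = φB ⟨α, hB⟩)

end Subgroups

end UTri

end

/-! Let β have row r and column s, and let π be the idempotent endomorphism of U that keeps only the
diagonal block with indices from r to s; it projects U onto U_β. Everything rests on the identity
(f₁g₁, f₂g₂) = (f₁, f₂)(g₁, g₂) of `charInner_mul_mul`, for f's coming from A and g's coming from B.
With orthonormality it makes every χ_A ⊗ χ_B irreducible and determines the pair; expanding ξ_A and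
ξ_B in irreducible characters (`eq_sum_charInner_smul`) shows that the products exhaust the
constituents of ξ_D = ξ_A ξ_B.

The identity needs two properties. The f's are right invariant under ker π. For the g's, right
translation by π(t) is a linear combination of right translations by elements of ker π, with
coefficients that do not depend on g. If Φ = f₁·conj f₂ and Ψ = g₁·conj g₂, then ∑ Φ(xt)Ψ(x) does
not depend on t, and summing over t separates the factors. Both properties pass from ξ_A and ξ_B to
their constituents, since these are combinations of left translates, and left translations commute
with right ones.

The main work is the absorption property of ξ_B (`RowSystem.sum_prod`). An elementary character is a
scaled sum of functions of a single row v, and π(t) = 1 + u sends v to v + vu. The hook condition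
leaves three positions for a root of B. In two of them u has no effect; in the third the root has
row < r and column > s. With Y' supported above the block and d' to its right, the element 1 + Y'u +
d' - Y'd' of ker π sends v to v + vY'u + (v - vY')d'. If vY' agrees with v on the columns r ≤ k < s
for all the rows concerned, this equals v + vu. Otherwise the sum over d' vanishes, because the λ_α
are nontrivial on X_α. The number of good Y does not depend on the rows, so dividing by a constant
gives the required combination. -/

noncomputable section

namespace UTri

/-! ### Sesquilinearity of the scalar product -/

section ScalarProduct

variable {G : Type*} [Fintype G]

lemma charInner_star_symm (f h : G → ℂ) :
    (starRingEnd ℂ) (charInner f h) = charInner h f := by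
  simp [charInner, map_sum, mul_comm]

lemma charInner_add_left (f f' h : G → ℂ) :
    charInner (f + f') h = charInner f h + charInner f' h := by
  simp [charInner, add_mul, Finset.sum_add_distrib, mul_add]

lemma charInner_smul_left (c : ℂ) (f h : G → ℂ) :
    charInner (c • f) h = c * charInner f h := by
  simp only [charInner, Pi.smul_apply, smul_eq_mul, Finset.mul_sum]
  exact Finset.sum_congr rfl fun _ _ => by ring

/-- The scalar product with a fixed second argument, as a linear functional. -/
def charInnerLeft (h : G → ℂ) : (G → ℂ) →ₗ[ℂ] ℂ where
  toFun f := charInner f h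
  map_add' f f' := charInner_add_left f f' h
  map_smul' c f := charInner_smul_left c f h

lemma charInner_sum_left {ι : Type*} (s : Finset ι) (c : ι → ℂ) (f : ι → G → ℂ) (h : G → ℂ) :
    charInner (∑ i ∈ s, c i • f i) h = ∑ i ∈ s, c i * charInner (f i) h := by
  have := map_sum (charInnerLeft h) (fun i => c i • f i) s
  simp only [charInnerLeft, LinearMap.coe_mk, AddHom.coe_mk, charInner_smul_left] at this
  exact this

end ScalarProduct

/-! ### Orthonormality of irreducible characters -/

section CharacterTheory

variable {G : Type*} [Group G]

/-- `f` is constant on conjugacy classes. -/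
def IsClassFun (f : G → ℂ) : Prop := ∀ x y, f (x * y) = f (y * x)

lemma isClassFun_of_mem_irrChar {χ : G → ℂ} (h : χ ∈ IrrChar G) : IsClassFun χ := by
  obtain ⟨d, ρ, -, rfl⟩ := h
  intro x y
  exact ρ.char_mul_comm y x

variable [Fintype G]

instance instNeZeroCardComplex : NeZero (Nat.card G : ℂ) :=
  ⟨Nat.cast_ne_zero.mpr Nat.card_pos.ne'⟩

instance instInvertibleCardComplex : Invertible (Nat.card G : ℂ) :=
  invertibleOfNonzero (NeZero.ne _)

open scoped ComplexOrder in
/-- On a finite group, complex conjugation turns `tr ρ(g)` into `tr ρ(g⁻¹)`. -/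
lemma star_character {d : ℕ} (ρ : Representation ℂ G (Fin d → ℂ)) (g : G) :
    (starRingEnd ℂ) (ρ.character g) = ρ.character g⁻¹ := by
  classical
  let M : G →* Matrix (Fin d) (Fin d) ℂ := (LinearMap.toMatrixAlgEquiv' : _ ≃ₐ[ℂ] _).toMonoidHom.comp ρ
  have htr : ∀ h, ρ.character h = (M h).trace := fun h => by
    rw [Representation.character, LinearMap.trace_eq_matrix_trace ℂ (Pi.basisFun ℂ (Fin d))]
    rfl
  have hMinv : ∀ h, M h * M h⁻¹ = 1 := fun h => by rw [← map_mul, mul_inv_cancel, map_one]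
  -- The Gram matrix of a G-invariant Hermitian form. Invariance makes the adjoint of `M g`
  -- conjugate to `M g⁻¹` through `P`, so the traces agree.
  let P : Matrix (Fin d) (Fin d) ℂ := ∑ h, (M h).conjTranspose * M h
  have hP : P.PosDef := by
    have : P = 1 + ∑ h ∈ Finset.univ.erase 1, (M h).conjTranspose * M h := by
      simp only [P]
      rw [← Finset.add_sum_erase _ _ (Finset.mem_univ (1 : G))]
      simp
    rw [this]
    exact Matrix.PosDef.one.add_posSemidef
      (Matrix.posSemidef_sum _ fun h _ => Matrix.posSemidef_conjTranspose_mul_self _)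
  have hinv : (M g).conjTranspose * P = P * M g⁻¹ := by
    have h1 : (M g).conjTranspose * P * M g = P := by
      simp only [P, Finset.mul_sum, Finset.sum_mul]
      refine Fintype.sum_equiv (Equiv.mulRight g) _ _ fun h => ?_
      simp [Matrix.conjTranspose_mul, Matrix.mul_assoc]
    calc (M g).conjTranspose * P = (M g).conjTranspose * P * (M g * M g⁻¹) := by
          rw [hMinv, Matrix.mul_one]
      _ = P * M g⁻¹ := by rw [← Matrix.mul_assoc, h1]
  have hdet : IsUnit P.det := (Matrix.isUnit_iff_isUnit_det _).mp hP.isUnit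
  rw [htr, htr, starRingEnd_apply, ← Matrix.trace_conjTranspose]
  calc (M g).conjTranspose.trace = ((M g).conjTranspose * P * P⁻¹).trace := by
        rw [Matrix.mul_nonsing_inv_cancel_right _ _ hdet]
    _ = (M g⁻¹).trace := by
        rw [hinv, Matrix.trace_mul_comm, ← Matrix.mul_assoc, Matrix.nonsing_inv_mul _ hdet,
          Matrix.one_mul]

lemma star_of_mem_irrChar {χ : G → ℂ} (h : χ ∈ IrrChar G) (g : G) :
    (starRingEnd ℂ) (χ g) = χ g⁻¹ := by
  obtain ⟨d, ρ, -, rfl⟩ := h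
  exact star_character ρ g

open scoped Classical in
lemma charInner_irrChar {χ ψ : G → ℂ} (hχ : χ ∈ IrrChar G) (hψ : ψ ∈ IrrChar G) :
    charInner χ ψ = if χ = ψ then 1 else 0 := by
  have key : charInner χ ψ = (Nat.card G : ℂ)⁻¹ * ∑ g, χ g * ψ g⁻¹ := by
    simp [charInner, star_of_mem_irrChar hψ, Nat.card_eq_fintype_card]
  rw [key]
  obtain ⟨d, ρ, hρ, rfl⟩ := hχ
  split_ifs with h
  · subst h
    rw [Representation.char_orthonormal ρ ρ, if_pos ⟨Representation.Equiv.refl ρ⟩]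
  · obtain ⟨e, σ, hσ, rfl⟩ := hψ
    rw [Representation.char_orthonormal ρ σ, if_neg]
    rintro ⟨φ⟩
    exact h (Representation.char_iso φ).symm

/-- Orthonormal functions are linearly independent in the finite-dimensional space of functions on
G. -/
lemma irrChar_finite : (IrrChar G).Finite := by
  have hli : LinearIndependent ℂ (Subtype.val : IrrChar G → (G → ℂ)) := by
    rw [linearIndependent_iff']
    intro s c hc i hi
    have := congrArg (fun f => charInner f i.1) hc
    simp only [charInner_sum_left] at this
    rw [Finset.sum_eq_single i, charInner_irrChar i.2 i.2, if_pos rfl] at this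
    · simpa [charInner] using this
    · intro j _ hj
      rw [charInner_irrChar j.2 i.2, if_neg (fun h => hj (Subtype.ext h)), mul_zero]
    · exact fun h => absurd hi h
  exact hli.setFinite

end CharacterTheory

/-! ### Irreducible characters span the class functions -/

section Completeness

open scoped MonoidAlgebra
open Module

/-- A representation on a finite-dimensional space has the character of one on `ℂ ^ d`. -/
lemma exists_character_eq {G : Type*} [Group G] {V : Type*} [AddCommGroup V] [Module ℂ V] [FiniteDimensional ℂ V]
    (ρ : Representation ℂ G V) :
    ∃ (d : ℕ) (σ : Representation ℂ G (Fin d → ℂ)), σ.character = ρ.character := by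
  let e : V ≃ₗ[ℂ] (Fin (finrank ℂ V) → ℂ) := (finBasis ℂ V).equivFun
  refine ⟨finrank ℂ V, (e.conjAlgEquiv ℂ : _ ≃ₐ[ℂ] _).toMonoidHom.comp ρ, ?_⟩
  ext g
  exact LinearMap.trace_conj' (ρ g) e

variable {G : Type*} [Group G] [Fintype G]

/-- A representation of a finite group with one-dimensional commutant is irreducible. -/
lemma isIrreducible_of_finrank_intertwiningMap_eq_one {V : Type*} [AddCommGroup V] [Module ℂ V]
    [FiniteDimensional ℂ V] (ρ : Representation ℂ G V)
    (h : finrank ℂ (Representation.IntertwiningMap ρ ρ) = 1) : ρ.IsIrreducible := by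
  rw [Representation.irreducible_iff_isSimpleModule_asModule]
  have h' : finrank ℂ (Module.End ℂ[G] ρ.asModule) = 1 := by
    rw [← h]
    exact (Representation.IntertwiningMap.equivAlgEnd (ρ := ρ)).toLinearEquiv.finrank_eq.symm
  have hne : (1 : Module.End ℂ[G] ρ.asModule) ≠ 0 := by
    intro h0
    have : Subsingleton (Module.End ℂ[G] ρ.asModule) :=
      subsingleton_of_zero_eq_one h0.symm
    rw [finrank_zero_of_subsingleton] at h'
    exact zero_ne_one h'
  have hnt : Nontrivial ρ.asModule := by
    by_contra hn
    rw [not_nontrivial_iff_subsingleton] at hn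
    exact hne (LinearMap.ext fun x => Subsingleton.elim _ _)
  rw [isSimpleModule_iff]
  refine ⟨fun p => ?_⟩
  -- Maschke gives a complement, so the projection onto `p` is an endomorphism, hence a scalar `c`.
  -- If `p` is nonzero, the projection fixes a nonzero vector, so `c = 1` and `p` is everything.
  obtain ⟨q, hq⟩ := exists_isCompl p
  obtain ⟨c, hc⟩ := (finrank_eq_one_iff_of_nonzero' _ hne).mp h'
    (p.subtype ∘ₗ p.projectionOnto q hq)
  by_cases hp : p = ⊥
  · exact Or.inl hp
  refine Or.inr (eq_top_iff.mpr fun x _ => ?_)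
  obtain ⟨y, hy, hy0⟩ := p.ne_bot_iff.mp hp
  have hcy : c • y = y := by
    have h1 := LinearMap.congr_fun hc y
    have h2 := congrArg Subtype.val (Submodule.projectionOnto_apply_left hq ⟨y, hy⟩)
    exact h1.trans h2
  have hc1 : c = 1 := by
    have : (c - 1) • y = 0 := by rw [sub_smul, hcy, one_smul, sub_self]
    exact sub_eq_zero.mp ((smul_eq_zero.mp this).resolve_right hy0)
  have := LinearMap.congr_fun hc x
  rw [hc1, one_smul] at this
  simp only [Module.End.one_apply, LinearMap.comp_apply, Submodule.subtype_apply] at this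
  rw [this]
  exact Subtype.mem _

lemma isIrreducible_of_sum_character_eq {V : Type*} [AddCommGroup V] [Module ℂ V]
    [FiniteDimensional ℂ V] (ρ : Representation ℂ G V)
    (h : (Nat.card G : ℂ)⁻¹ * ∑ g, ρ.character g * ρ.character g⁻¹ = 1) : ρ.IsIrreducible := by
  apply isIrreducible_of_finrank_intertwiningMap_eq_one
  rw [Representation.card_inv_mul_sum_char_mul_char_eq_finrank] at h
  exact_mod_cast h

lemma character_mem_irrChar_of_sum_eq {V : Type*} [AddCommGroup V] [Module ℂ V]
    [FiniteDimensional ℂ V] (ρ : Representation ℂ G V)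
    (h : (Nat.card G : ℂ)⁻¹ * ∑ g, ρ.character g * ρ.character g⁻¹ = 1) :
    ρ.character ∈ IrrChar G := by
  obtain ⟨d, σ, hσ⟩ := exists_character_eq ρ
  exact ⟨d, σ, isIrreducible_of_sum_character_eq σ (by rw [hσ]; exact h), hσ⟩

lemma character_mem_irrChar {V : Type*} [AddCommGroup V] [Module ℂ V]
    [FiniteDimensional ℂ V] (ρ : Representation ℂ G V) (hρ : ρ.IsIrreducible) :
    ρ.character ∈ IrrChar G := by
  apply character_mem_irrChar_of_sum_eq
  rw [Representation.char_orthonormal ρ ρ, if_pos ⟨Representation.Equiv.refl ρ⟩]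

/-- A product of irreducible characters that has norm one is irreducible. -/
lemma mul_mem_irrChar {χ ψ : G → ℂ} (hχ : χ ∈ IrrChar G) (hψ : ψ ∈ IrrChar G)
    (h : charInner (χ * ψ) (χ * ψ) = 1) : χ * ψ ∈ IrrChar G := by
  have hχ' := star_of_mem_irrChar hχ
  have hψ' := star_of_mem_irrChar hψ
  obtain ⟨d, ρ, -, rfl⟩ := hχ
  obtain ⟨e, σ, -, rfl⟩ := hψ
  rw [← Representation.char_tensor]
  apply character_mem_irrChar_of_sum_eq
  rw [← h, Representation.char_tensor]
  simp [charInner, hχ', hψ', Nat.card_eq_fintype_card]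

/-- By Schur's lemma a class function acts on an irreducible representation by a scalar. -/
lemma exists_sum_smul_eq_algebraMap {V : Type*} [AddCommGroup V] [Module ℂ V]
    [FiniteDimensional ℂ V] (ρ : Representation ℂ G V) (hρ : ρ.IsIrreducible) {f : G → ℂ}
    (hf : IsClassFun f) : ∃ s : ℂ, ∑ y, f y • ρ y⁻¹ = s • (1 : Module.End ℂ V) := by
  have hcomm : ∀ g, (∑ y, f y • ρ y⁻¹) * ρ g = ρ g * ∑ y, f y • ρ y⁻¹ := by
    intro g
    rw [Finset.sum_mul, Finset.mul_sum]
    refine Fintype.sum_equiv (MulAut.conj g⁻¹).toEquiv _ _ fun y => ?_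
    simp only [MulEquiv.toEquiv_eq_coe, EquivLike.coe_coe, MulAut.conj_apply, inv_inv]
    rw [smul_mul_assoc, mul_smul_comm, ← map_mul, ← map_mul, hf (g⁻¹ * y) g]
    congr 2
    · group
    · group
  let T : Representation.IntertwiningMap ρ ρ :=
    ⟨∑ y, f y • ρ y⁻¹, fun g => hcomm g⟩
  obtain ⟨s, hs⟩ :=
    Representation.IsIrreducible.algebraMap_intertwiningMap_bijective_of_isAlgClosed.2 T
  refine ⟨s, ?_⟩
  have := congrArg (fun S : Representation.IntertwiningMap ρ ρ => S.toLinearMap) hs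
  exact this.symm

/-- The trace of Schur's scalar identity multiplied by `ρ x`: convolution with a class function has
χ as an eigenvector. -/
lemma exists_sum_mul_eq {χ f : G → ℂ} (hχ : χ ∈ IrrChar G) (hf : IsClassFun f) :
    ∃ s : ℂ, ∀ x, ∑ y, f y * χ (y⁻¹ * x) = s * χ x := by
  obtain ⟨d, ρ, hρ, rfl⟩ := hχ
  obtain ⟨s, hs⟩ := exists_sum_smul_eq_algebraMap ρ hρ hf
  refine ⟨s, fun x => ?_⟩
  have := congrArg (fun T => LinearMap.trace ℂ _ (T * ρ x)) hs
  simpa [Finset.sum_mul, Representation.character] using this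

/-- An irreducible constituent of a class function `f` is a combination of translates of `f`. -/
lemma exists_eq_sum_of_mem_constituents {χ f : G → ℂ} (h : χ ∈ constituents f)
    (hf : IsClassFun f) : ∃ c : G → ℂ, ∀ x, χ x = ∑ z, c z * f (z * x) := by
  obtain ⟨s, hs⟩ := exists_sum_mul_eq h.1 hf
  -- At 1 the eigenvector equation reads s·χ(1) = |G|·(f, χ), so s = 0 would make the scalar product
  -- vanish.
  have hs0 : s ≠ 0 := by
    rintro rfl
    apply h.2
    rw [← charInner_star_symm, charInner]
    have := hs 1
    simp only [mul_one, zero_mul] at this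
    simp only [star_of_mem_irrChar h.1, this, mul_zero, map_zero]
  refine ⟨fun z => s⁻¹ * χ z⁻¹, fun x => ?_⟩
  simp only [mul_assoc, ← Finset.mul_sum]
  rw [eq_inv_mul_iff_mul_eq₀ hs0, ← hs x]
  refine (Fintype.sum_equiv (Equiv.mulLeft x) _ _ fun z => ?_).symm
  rw [Equiv.coe_mulLeft, hf z x, mul_inv_rev, inv_mul_cancel_right, mul_comm]

/-- The element `∑ f(y) y⁻¹` of the group algebra attached to a function `f`. -/
def groupAlgebraElt (f : G → ℂ) : ℂ[G] := ∑ y, MonoidAlgebra.single y⁻¹ (f y)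

/-- A class function orthogonal to all irreducible characters kills all simple modules. -/
lemma groupAlgebraElt_smul_eq_zero {f : G → ℂ} (hf : IsClassFun f)
    (h : ∀ χ ∈ IrrChar G, charInner f χ = 0) (M : Type*) [AddCommGroup M] [Module ℂ M]
    [Module ℂ[G] M] [IsScalarTower ℂ ℂ[G] M]
    [IsSimpleModule ℂ[G] M] (m : M) : groupAlgebraElt f • m = 0 := by
  let ρ : Representation ℂ G M := Representation.ofModule' M
  have hρ : ∀ (r : ℂ[G]) (x : M), ρ.asAlgebraHom r x = r • x := fun r x => by
    rw [Representation.asAlgebraHom_def]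
    simp only [ρ, Representation.ofModule', Equiv.apply_symm_apply]
    rfl
  let e : ρ.asModule ≃ₗ[ℂ[G]] M :=
    { ρ.asModuleEquiv.toAddEquiv with map_smul' := fun r x => hρ r (ρ.asModuleEquiv x) }
  have hirr : ρ.IsIrreducible :=
    ρ.irreducible_iff_isSimpleModule_asModule.mpr (IsSimpleModule.congr e)
  have hfin : FiniteDimensional ℂ M := Module.Finite.trans ℂ[G] _
  obtain ⟨s, hs⟩ := exists_sum_smul_eq_algebraMap ρ hirr hf
  have hχ := character_mem_irrChar ρ hirr
  have hpos : (finrank ℂ M : ℂ) ≠ 0 := by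
    have : Nontrivial M := IsSimpleModule.nontrivial ℂ[G] M
    exact_mod_cast finrank_pos.ne'
  have hs0 : s = 0 := by
    have h1 := congrArg (LinearMap.trace ℂ _) hs
    have h2 := h _ hχ
    simp only [charInner, star_of_mem_irrChar hχ, mul_eq_zero, inv_eq_zero,
      Nat.cast_eq_zero, Fintype.card_ne_zero, false_or] at h2
    simp only [map_sum, map_smul, smul_eq_mul, LinearMap.trace_one] at h1
    exact (mul_eq_zero.mp (h1.symm.trans h2)).resolve_right hpos
  rw [← hρ]
  simp only [groupAlgebraElt, map_sum, Representation.asAlgebraHom_single]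
  rw [hs, hs0, zero_smul, LinearMap.zero_apply]

/-- A class function orthogonal to all irreducible characters vanishes. -/
lemma eq_zero_of_forall_charInner_eq_zero {f : G → ℂ} (hf : IsClassFun f)
    (h : ∀ χ ∈ IrrChar G, charInner f χ = 0) : f = 0 := by
  -- The element kills the class of 1 in each simple quotient by a maximal left ideal, so it lies in
  -- all such ideals; by semisimplicity of ℂ[G] their intersection is zero.
  have ha : groupAlgebraElt f ∈ Ring.jacobson ℂ[G] := by
    rw [Ring.jacobson_eq_sInf_isMaximal, Ideal.mem_sInf]
    intro I (hI : I.IsMaximal)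
    have hsimple : IsSimpleModule ℂ[G] (ℂ[G] ⧸ I) :=
      isSimpleModule_iff_isCoatom.mpr hI.out
    have := groupAlgebraElt_smul_eq_zero hf h (ℂ[G] ⧸ I) (Submodule.Quotient.mk 1)
    rw [← Submodule.Quotient.mk_smul, Submodule.Quotient.mk_eq_zero] at this
    simpa using this
  rw [IsSemisimpleRing.jacobson_eq_bot] at ha
  have ha0 : groupAlgebraElt f = 0 := ha
  classical
  funext y
  have := congrArg (fun b : ℂ[G] => b.coeff y⁻¹) ha0
  simpa [groupAlgebraElt, Finsupp.single_apply] using this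

/-- A class function is the sum of its projections to the irreducible characters. -/
lemma eq_sum_charInner_smul {f : G → ℂ} (hf : IsClassFun f) :
    f = ∑ χ ∈ irrChar_finite.toFinset, charInner f χ • χ := by
  rw [← sub_eq_zero]
  apply eq_zero_of_forall_charInner_eq_zero
  · intro x y
    simp only [Pi.sub_apply, Finset.sum_apply, Pi.smul_apply]
    rw [hf x y]
    congr 1
    refine Finset.sum_congr rfl fun χ hχ => ?_
    rw [isClassFun_of_mem_irrChar (irrChar_finite.mem_toFinset.mp hχ) x y]
  · intro ψ hψ
    classical
    have : charInner (f - ∑ χ ∈ irrChar_finite.toFinset, charInner f χ • χ) ψ =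
        charInner f ψ - charInner (∑ χ ∈ irrChar_finite.toFinset, charInner f χ • χ) ψ :=
      map_sub (charInnerLeft ψ) _ _
    rw [this, charInner_sum_left, Finset.sum_eq_single ψ, charInner_irrChar hψ hψ, if_pos rfl,
      mul_one, sub_self]
    · intro χ hχ hne
      rw [charInner_irrChar (irrChar_finite.mem_toFinset.mp hχ) hψ, if_neg hne, mul_zero]
    · exact fun hn => absurd (irrChar_finite.mem_toFinset.mpr hψ) hn

end Completeness

/-! ### Matrix entries and groups generated by root subgroups -/

section Unitriangular

variable {n : ℕ} {F : Type*} [Field F]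

/-- The underlying matrix of an element of `U_n(F)`. -/
def mat (g : U n F) : Matrix (Fin n) (Fin n) F := (g : GL (Fin n) F).1

lemma mat_injective : Function.Injective (mat : U n F → Matrix (Fin n) (Fin n) F) :=
  fun _ _ h => Subtype.ext (Units.ext h)

lemma mat_mul (g h : U n F) : mat (g * h) = mat g * mat h := rfl

lemma mat_one : mat (1 : U n F) = 1 := rfl

lemma mat_diag (g : U n F) (i : Fin n) : mat g i i = 1 := g.2.1 i

lemma mat_lower (g : U n F) {i j : Fin n} (h : j < i) : mat g i j = 0 := g.2.2 i j h

lemma mat_rootElt (α : PosRoot n) (c : F) :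
    mat (rootElt F α c) = Matrix.transvection α.row α.col c := rfl

lemma mat_rootElt_apply (α : PosRoot n) (c : F) (k l : Fin n) :
    mat (rootElt F α c) k l =
      (1 : Matrix (Fin n) (Fin n) F) k l + if α.row = k ∧ α.col = l then c else 0 := by
  rw [mat_rootElt, Matrix.transvection, Matrix.add_apply, Matrix.single_apply]

/-- The element of `U_n(F)` with a given unitriangular matrix. -/
def ofMat (M : Matrix (Fin n) (Fin n) F) (hd : ∀ i, M i i = 1) (hl : ∀ i j, j < i → M i j = 0) :
    U n F :=
  ⟨Matrix.GeneralLinearGroup.mkOfDetNeZero M (by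
    rw [Matrix.det_of_isUpperTriangular (fun i j h => hl i j h)]
    simp [hd]), hd, hl⟩

lemma mat_mul_mat_inv (g : U n F) : mat g * mat g⁻¹ = 1 := by
  rw [← mat_mul, mul_inv_cancel, mat_one]

lemma mat_inv_mul_mat (g : U n F) : mat g⁻¹ * mat g = 1 := by
  rw [← mat_mul, inv_mul_cancel, mat_one]

/-- Row `i` of `g`, as a vector. -/
def rowVec (g : U n F) (i : Fin n) : Fin n → F := fun k => mat g i k

lemma rowVec_mul (g h : U n F) (i : Fin n) :
    rowVec (g * h) i = Matrix.vecMul (rowVec g i) (mat h) := by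
  funext k
  simp [rowVec, mat_mul, Matrix.mul_apply, Matrix.vecMul, dotProduct]

lemma rootElt_add (α : PosRoot n) (c d : F) :
    rootElt F α (c + d) = rootElt F α c * rootElt F α d :=
  mat_injective (by
    rw [mat_mul, mat_rootElt, mat_rootElt, mat_rootElt,
      Matrix.transvection_mul_transvection_same _ _ α.lt.ne])

lemma rootElt_zero (α : PosRoot n) : rootElt F α 0 = 1 :=
  mat_injective (Matrix.transvection_zero _ _)

lemma rootElt_mem_X (α : PosRoot n) (c : F) : rootElt F α c ∈ X F α := ⟨c, rfl⟩

/-- A unitriangular matrix whose entries are supported on `S` is a product of elements of the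
root subgroups `X_β`, `β ∈ S`. -/
lemma mem_iSup_X_of_support {S : Set (PosRoot n)} (g : U n F)
    (hg : ∀ α : PosRoot n, mat g α.row α.col ≠ 0 → α ∈ S) : g ∈ ⨆ β ∈ S, X F β := by
  classical
  let supp : U n F → Finset (Fin n × Fin n) := fun g =>
    Finset.univ.filter fun p => p.1 < p.2 ∧ mat g p.1 p.2 ≠ 0
  induction hN : (supp g).card using Nat.strong_induction_on generalizing g with
  | _ N ih =>
    rcases (supp g).eq_empty_or_nonempty with h0 | h0
    · have : g = 1 := by
        apply mat_injective
        ext i j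
        rw [mat_one]
        rcases lt_trichotomy i j with h | rfl | h
        · rw [Matrix.one_apply_ne h.ne]
          by_contra hne
          have : (i, j) ∈ supp g := by simp [supp, h, hne]
          rw [h0] at this
          simp at this
        · rw [mat_diag, Matrix.one_apply_eq]
        · rw [mat_lower g h, Matrix.one_apply_ne h.ne']
      rw [this]
      exact one_mem _
    -- For a nonzero entry (a, b) in the topmost possible row, column a is the unit vector e_a.
    -- Right multiplication by x_{(a,b)}(c) therefore changes only the entry (a, b), which can be
    -- cleared.
    · obtain ⟨⟨a, b⟩, hab, hmin⟩ := Finset.exists_min_image (supp g) Prod.fst h0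
      simp only [supp, Finset.mem_filter, Finset.mem_univ, true_and] at hab
      let α : PosRoot n := ⟨a, b, hab.1⟩
      have hcol : ∀ k, k ≠ a → mat g k a = 0 := by
        intro k hk
        rcases lt_or_gt_of_ne hk with h | h
        · by_contra hne
          have := hmin (k, a) (by simp [supp, h, hne])
          exact absurd this (not_le.mpr h)
        · exact mat_lower g h
      let g' := g * rootElt F α (-mat g a b)
      have hg' : ∀ k l, mat g' k l = if k = a ∧ l = b then 0 else mat g k l := by
        intro k l
        simp only [g', mat_mul, mat_rootElt]
        by_cases hl : l = b
        · subst hl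
          rw [show α.col = l from rfl, Matrix.mul_transvection_apply_same]
          by_cases hk : k = a
          · subst hk
            simp [α, mat_diag]
          · simp [hk, α, hcol k hk]
        · rw [Matrix.mul_transvection_apply_of_ne _ _ _ _ hl, if_neg (fun h => hl h.2)]
      have hmem : g' ∈ ⨆ β ∈ S, X F β := by
        refine ih _ ?_ g' ?_ rfl
        · rw [← hN]
          apply Finset.card_lt_card
          rw [Finset.ssubset_iff_of_subset]
          · exact ⟨(a, b), by simpa [supp] using hab, by simp [supp, hg']⟩
          · intro p hp
            simp only [supp, Finset.mem_filter, Finset.mem_univ, true_and, hg'] at hp ⊢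
            refine ⟨hp.1, fun h => hp.2 ?_⟩
            split_ifs
            · rfl
            · exact h
        · intro γ hγ
          apply hg
          intro h
          apply hγ
          rw [hg', h, ite_self]
      have hα : rootElt F α (mat g a b) ∈ ⨆ β ∈ S, X F β :=
        (le_biSup (X F) (hg α hab.2)) (rootElt_mem_X α _)
      have : g = g' * rootElt F α (mat g a b) := by
        simp only [g']
        rw [mul_assoc, ← rootElt_add, neg_add_cancel, rootElt_zero, mul_one]
      rw [this]
      exact mul_mem hmem hα

lemma iSup_X_induction {S : Set (PosRoot n)} {P : U n F → Prop}
    (hX : ∀ β ∈ S, ∀ c, P (rootElt F β c)) (h1 : P 1) (hmul : ∀ g h, P g → P h → P (g * h))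
    {g : U n F} (hg : g ∈ ⨆ β ∈ S, X F β) : P g := by
  rw [iSup_subtype'] at hg
  refine Subgroup.iSup_induction _ (C := P) hg ?_ h1 hmul
  rintro ⟨β, hβ⟩ _ ⟨c, rfl⟩
  exact hX β hβ c

/-- With no entry of g on the arm, only the two diagonal terms of the product survive. Hence
vanishing on the arm is closed under products, and the entry at α is additive on V_α. -/
lemma armFree_mul {α : PosRoot n} {g h : U n F}
    (hg : ∀ l, α.row < l → l < α.col → mat g α.row l = 0)
    {l : Fin n} (hl : α.row < l)
    (hl' : l ≤ α.col) : mat (g * h) α.row l = mat g α.row l + mat h α.row l := by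
  rw [mat_mul, Matrix.mul_apply, Finset.sum_eq_add_of_mem α.row l (Finset.mem_univ _)
    (Finset.mem_univ _) hl.ne, mat_diag, mat_diag, one_mul, mul_one, add_comm]
  intro k _ hk
  rcases lt_or_gt_of_ne hk.1 with h1 | h1
  · rw [mat_lower g h1, zero_mul]
  · rcases lt_or_gt_of_ne hk.2 with h2 | h2
    · rw [hg k h1 (h2.trans_le hl'), zero_mul]
    · rw [mat_lower h h2, mul_zero]

lemma mem_baseGroup_iff (α : PosRoot n) (g : U n F) :
    g ∈ baseGroup F α ↔ ∀ l, α.row < l → l < α.col → mat g α.row l = 0 := by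
  constructor
  · intro hg
    refine iSup_X_induction (P := fun g => ∀ l, α.row < l → l < α.col → mat g α.row l = 0)
      ?_ ?_ ?_ hg
    · intro β hβ c l hl hl'
      rw [mat_rootElt_apply, Matrix.one_apply_ne hl.ne, zero_add, if_neg]
      rintro ⟨h1, h2⟩
      exact hβ ⟨h1, h2 ▸ hl'⟩
    · intro l hl _
      rw [mat_one, Matrix.one_apply_ne hl.ne]
    · intro g h hg hh l hl hl'
      rw [armFree_mul hg hl hl'.le, hg l hl hl', hh l hl hl', add_zero]
  · intro hg
    refine mem_iSup_X_of_support g fun γ hγ hγα => hγ ?_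
    rw [hγα.1]
    exact hg _ (hγα.1 ▸ γ.lt) hγα.2

end Unitriangular

/-! ### Elementary characters as sums of functions of one row -/

section ElementaryCharacters

variable {n : ℕ} {F : Type*} [Field F] {α : PosRoot n}

lemma X_le_baseGroup {β : PosRoot n} (h : β ∉ α.arm) : X F β ≤ baseGroup F α :=
  le_biSup (X F) (i := β) h

lemma self_notMem_arm : α ∉ α.arm := fun h => lt_irrefl _ h.2

lemma rootElt_mem_baseGroup (c : F) : rootElt F α c ∈ baseGroup F α :=
  X_le_baseGroup self_notMem_arm (rootElt_mem_X α c)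

/-- The additive character `c ↦ λ(x_α(c))` of `F`. -/
def rootChar (l : LinChar F α) (c : F) : ℂ :=
  ((l.1 ⟨rootElt F α c, rootElt_mem_baseGroup c⟩ : ℂˣ) : ℂ)

lemma rootChar_add (l : LinChar F α) (c d : F) :
    rootChar l (c + d) = rootChar l c * rootChar l d := by
  rw [rootChar, rootChar, rootChar, ← Units.val_mul, ← map_mul]
  congr 3
  exact rootElt_add α c d

lemma rootChar_zero (l : LinChar F α) : rootChar l 0 = 1 := by
  have : (⟨rootElt F α 0, rootElt_mem_baseGroup 0⟩ : baseGroup F α) = 1 :=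
    Subtype.ext (rootElt_zero α)
  rw [rootChar, this, map_one, Units.val_one]

lemma exists_rootChar_ne_one (l : LinChar F α) : ∃ c, rootChar l c ≠ 1 := by
  obtain ⟨⟨v, hv⟩, ⟨c, rfl⟩, h⟩ := l.2.1
  exact ⟨c, fun h' => h (Units.ext h')⟩

/-- Both sides are multiplicative on V_α, by additivity of the entry at α, so it suffices to compare
them on root elements. -/
lemma linChar_apply (l : LinChar F α) (v : baseGroup F α) :
    ((l.1 v : ℂˣ) : ℂ) = rootChar l (mat v.1 α.row α.col) := by
  obtain ⟨v, hv⟩ := v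
  refine (iSup_X_induction (S := α.armᶜ) (P := fun v => ∃ h : v ∈ baseGroup F α,
    ((l.1 ⟨v, h⟩ : ℂˣ) : ℂ) = rootChar l (mat v α.row α.col)) ?_ ?_ ?_ hv).2
  · intro β hβ c
    have hmem := X_le_baseGroup hβ (rootElt_mem_X β c)
    refine ⟨hmem, ?_⟩
    rw [mat_rootElt_apply, Matrix.one_apply_ne α.lt.ne, zero_add]
    by_cases h : β = α
    · subst h
      rw [if_pos ⟨rfl, rfl⟩]
      rfl
    · rw [if_neg (fun h' => h (PosRoot.ext h'.1 h'.2)), rootChar_zero,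
        l.2.2 β h (X_le_baseGroup hβ) ⟨_, hmem⟩ (rootElt_mem_X β c), Units.val_one]
  · refine ⟨one_mem _, ?_⟩
    rw [mat_one, Matrix.one_apply_ne α.lt.ne, rootChar_zero]
    exact congrArg Units.val (map_one l.1)
  · rintro g h ⟨hg, hg'⟩ ⟨hh, hh'⟩
    refine ⟨mul_mem hg hh, ?_⟩
    rw [armFree_mul ((mem_baseGroup_iff α g).mp hg) α.lt le_rfl,
      rootChar_add, ← hg', ← hh', ← Units.val_mul, ← map_mul]
    rfl

open scoped Classical in
/-- The extension by zero of the linear character of `V_α`, as a function of row `i` of a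
matrix. -/
def rowFun (l : LinChar F α) (w : Fin n → F) : ℂ :=
  if ∀ k < α.col, w k = (1 : Matrix (Fin n) (Fin n) F) α.row k then rootChar l (w α.col) else 0

lemma rowFun_add (l : LinChar F α) (w c : Fin n → F) (hc : ∀ k < α.col, c k = 0) :
    rowFun l (w + c) = rootChar l (c α.col) * rowFun l w := by
  have : (∀ k < α.col, (w + c) k = (1 : Matrix (Fin n) (Fin n) F) α.row k) ↔
      ∀ k < α.col, w k = (1 : Matrix (Fin n) (Fin n) F) α.row k :=
    forall₂_congr fun k hk => by rw [Pi.add_apply, hc k hk, add_zero]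
  rw [rowFun, rowFun]
  by_cases h : ∀ k < α.col, w k = (1 : Matrix (Fin n) (Fin n) F) α.row k
  · rw [if_pos h, if_pos (this.mpr h), Pi.add_apply, rootChar_add, mul_comm]
  · rw [if_neg h, if_neg (fun h' => h (this.mp h')), mul_zero]

lemma vecMul_mat_apply_of_lt {c : Fin n → F} {j : Fin n} (hc : ∀ k < j, c k = 0) (z : U n F)
    {k : Fin n} (hk : k < j) : Matrix.vecMul c (mat z) k = 0 := by
  rw [Matrix.vecMul, dotProduct]
  refine Finset.sum_eq_zero fun m _ => ?_
  rcases lt_or_ge m j with h | h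
  · rw [hc m h, zero_mul]
  · rw [mat_lower z (hk.trans_le h), mul_zero]

lemma vecMul_mat_apply_self {c : Fin n → F} {j : Fin n} (hc : ∀ k < j, c k = 0) (z : U n F) :
    Matrix.vecMul c (mat z) j = c j := by
  rw [Matrix.vecMul, dotProduct, Finset.sum_eq_single_of_mem j (Finset.mem_univ _), mat_diag,
    mul_one]
  intro m _ hm
  rcases lt_or_gt_of_ne hm with h | h
  · rw [hc m h, zero_mul]
  · rw [mat_lower z h, mul_zero]

/-- The row functions whose sum is, up to a constant, the elementary character. -/
def rowFunAt (l : LinChar F α) (z : U n F) (w : Fin n → F) : ℂ :=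
  rowFun l (Matrix.vecMul w (mat z))

lemma rowFunAt_add (l : LinChar F α) (z : U n F) (w c : Fin n → F) (hc : ∀ k < α.col, c k = 0) :
    rowFunAt l z (w + c) = rootChar l (c α.col) * rowFunAt l z w := by
  rw [rowFunAt, Matrix.add_vecMul, rowFun_add l _ _ fun k hk => vecMul_mat_apply_of_lt hc z hk,
    vecMul_mat_apply_self hc z, rowFunAt]

variable [Finite F]

/-- Membership of z⁻¹gz in V_α and the value of λ there depend only on row i of that matrix, which
is row i of z⁻¹g times z. -/
lemma elementaryChar_apply (l : LinChar F α) (g : U n F) :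
    elementaryChar l g =
      (Nat.card (baseGroup F α) : ℂ)⁻¹ * ∑ z : U n F, rowFunAt l z (rowVec (z⁻¹ * g) α.row) := by
  classical
  simp only [elementaryChar, inducedChar]
  congr 1
  refine Finset.sum_congr rfl fun z _ => ?_
  rw [rowFunAt, ← rowVec_mul, rowFun]
  have : z⁻¹ * g * z ∈ baseGroup F α ↔ ∀ k < α.col, rowVec (z⁻¹ * g * z) α.row k =
      (1 : Matrix (Fin n) (Fin n) F) α.row k := by
    rw [mem_baseGroup_iff]
    constructor
    · intro h k hk
      rcases lt_trichotomy α.row k with h1 | h1 | h1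
      · rw [Matrix.one_apply_ne h1.ne]
        exact h k h1 hk
      · rw [← h1, Matrix.one_apply_eq]
        exact mat_diag _ _
      · rw [Matrix.one_apply_ne h1.ne']
        exact mat_lower _ h1
    · intro h k hk hk'
      rw [← Matrix.one_apply_ne hk.ne]
      exact h k hk'
  by_cases h : z⁻¹ * g * z ∈ baseGroup F α
  · rw [dif_pos h, if_pos (this.mp h), linChar_apply]
    rfl
  · rw [dif_neg h, if_neg (fun h' => h (this.mpr h'))]

lemma isClassFun_inducedChar {G : Type*} [Group G] [Fintype G] (H : Subgroup G) (θ : H → ℂ) :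
    IsClassFun (inducedChar H θ) := by
  classical
  intro x y
  simp only [inducedChar]
  congr 1
  refine Fintype.sum_equiv (Equiv.mulLeft x⁻¹) _ _ fun z => ?_
  have : (x⁻¹ * z)⁻¹ * (y * x) * (x⁻¹ * z) = z⁻¹ * (x * y) * z := by group
  simp only [Equiv.coe_mulLeft, this]

lemma isClassFun_basicChar (D : Finset (PosRoot n)) (φ : CharFamily F D) :
    IsClassFun (basicChar D φ) := by
  intro x y
  simp only [basicChar, Finset.prod_apply]
  exact Finset.prod_congr rfl fun α _ => isClassFun_inducedChar _ _ x y

end ElementaryCharacters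

/-! ### Multiplicativity of the scalar product -/

section Factorization

variable {G : Type*} [Group G] [Fintype G] {Ω : Type*} [Fintype Ω]

/-- Right translation of `f` by `t` is the combination, with coefficient `κ`, of its right
translations by the elements `q ω`. -/
def AbsorbsTranslation (κ : ℂ) (q : Ω → G) (t : G) (f : G → ℂ) : Prop :=
  ∀ x, f (x * t) = κ * ∑ ω, f (x * q ω)

lemma AbsorbsTranslation.of_mem_constituents {κ : ℂ} {q : Ω → G} {t : G} {f χ : G → ℂ}
    (h : AbsorbsTranslation κ q t f) (hf : IsClassFun f) (hχ : χ ∈ constituents f) :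
    AbsorbsTranslation κ q t χ := by
  obtain ⟨c, hc⟩ := exists_eq_sum_of_mem_constituents hχ hf
  intro x
  simp only [hc, ← mul_assoc]
  rw [Finset.sum_comm, Finset.mul_sum]
  refine Finset.sum_congr rfl fun z _ => ?_
  rw [h, ← Finset.mul_sum]
  ring

lemma invariant_of_mem_constituents {f χ : G → ℂ} {y : G} (h : ∀ x, f (x * y) = f x)
    (hf : IsClassFun f) (hχ : χ ∈ constituents f) (x : G) : χ (x * y) = χ x := by
  obtain ⟨c, hc⟩ := exists_eq_sum_of_mem_constituents hχ hf
  simp only [hc, ← mul_assoc, h]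

/-- After x is replaced by xt, the translation of g₁ is spread over the q ω. These move past Φ
because N is normal, and they recombine in g₂ to cancel its t⁻¹. Since conj g₂(x) = g₂(x⁻¹), the
same κ serves both times, without conjugation. -/
lemma sum_mul_eq_sum_translate {N : Subgroup G} [N.Normal] {κ : ℂ} {q : Ω → G} {t : G}
    (hq : ∀ ω, q ω ∈ N) {Φ g₁ g₂ : G → ℂ} (hΦ : ∀ x, ∀ y ∈ N, Φ (x * y) = Φ x)
    (hg₁ : AbsorbsTranslation κ q t g₁) (hg₂ : AbsorbsTranslation κ q t g₂)
    (hirr : g₂ ∈ IrrChar G) :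
    ∑ x, Φ x * (g₁ x * (starRingEnd ℂ) (g₂ x)) =
      ∑ x, Φ (x * t) * (g₁ x * (starRingEnd ℂ) (g₂ x)) := by
  have hcl := isClassFun_of_mem_irrChar hirr
  simp only [star_of_mem_irrChar hirr]
  calc ∑ x, Φ x * (g₁ x * g₂ x⁻¹) = ∑ x, Φ (x * t) * (g₁ (x * t) * g₂ (x * t)⁻¹) :=
        (Fintype.sum_equiv (Equiv.mulRight t) _ _ fun x => rfl).symm
    _ = κ * ∑ ω, ∑ x, Φ (x * t) * (g₁ (x * q ω) * g₂ (x * t)⁻¹) := by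
        rw [Finset.sum_comm, Finset.mul_sum]
        refine Finset.sum_congr rfl fun x _ => ?_
        rw [hg₁, ← Finset.mul_sum, ← Finset.sum_mul]
        ring
    _ = κ * ∑ ω, ∑ x, Φ (x * t) * (g₁ x * g₂ (x⁻¹ * t⁻¹ * q ω)) := by
        congr 1
        refine Finset.sum_congr rfl fun ω _ => ?_
        refine Fintype.sum_equiv (Equiv.mulRight (q ω)) _ _ fun x => ?_
        rw [Equiv.coe_mulRight]
        have h1 : Φ (x * q ω * t) = Φ (x * t) := by
          have : x * q ω * t = x * t * (t⁻¹ * q ω * t) := by group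
          rw [this]
          apply hΦ
          simpa using Subgroup.Normal.conj_mem inferInstance (q ω) (hq ω) t⁻¹
        have h2 : g₂ ((x * q ω)⁻¹ * t⁻¹ * q ω) = g₂ (x * t)⁻¹ := by
          rw [hcl, mul_inv_rev x t, hcl t⁻¹]
          congr 1
          group
        rw [h1, h2]
    _ = ∑ x, Φ (x * t) * (g₁ x * g₂ x⁻¹) := by
        rw [Finset.sum_comm, Finset.mul_sum]
        refine Finset.sum_congr rfl fun x _ => ?_
        have := hg₂ (x⁻¹ * t⁻¹)
        rw [inv_mul_cancel_right] at this
        rw [this, ← Finset.mul_sum, ← Finset.mul_sum]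
        ring

/-- The scalar product is multiplicative for products of functions on `G / ker π` with functions
whose translations by the image of `π` are absorbed by `ker π`. -/
lemma charInner_mul_mul {π : G →* G} (hπ : ∀ y, π (π y) = π y) {κ : ℂ} {q : G → Ω → G}
    (hq : ∀ t ω, π (q t ω) = 1) {f₁ f₂ g₁ g₂ : G → ℂ}
    (hf₁ : ∀ x y, π y = 1 → f₁ (x * y) = f₁ x) (hf₂ : ∀ x y, π y = 1 → f₂ (x * y) = f₂ x)
    (hg₁ : ∀ t, AbsorbsTranslation κ (q t) (π t) g₁)
    (hg₂ : ∀ t, AbsorbsTranslation κ (q t) (π t) g₂) (hirr : g₂ ∈ IrrChar G) :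
    charInner (f₁ * g₁) (f₂ * g₂) = charInner f₁ f₂ * charInner g₁ g₂ := by
  set Φ : G → ℂ := fun x => f₁ x * (starRingEnd ℂ) (f₂ x)
  set Ψ : G → ℂ := fun x => g₁ x * (starRingEnd ℂ) (g₂ x)
  have hΦ : ∀ x, ∀ y ∈ π.ker, Φ (x * y) = Φ x := fun x y hy => by
    simp only [Φ, hf₁ x y hy, hf₂ x y hy]
  -- Since y and π(y) differ by an element of ker π, which Φ ignores, translation by π(y) suffices.
  have key : ∀ y, ∑ x, Φ x * Ψ x = ∑ x, Φ (x * y) * Ψ x := by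
    intro y
    rw [sum_mul_eq_sum_translate (N := π.ker) (hq y) hΦ (hg₁ y) (hg₂ y) hirr]
    refine Finset.sum_congr rfl fun x _ => ?_
    have : x * y = x * π y * ((π y)⁻¹ * y) := by group
    rw [this, hΦ (x * π y)]
    rw [MonoidHom.mem_ker, map_mul, map_inv, hπ, inv_mul_cancel]
  have hsum : (Fintype.card G : ℂ) * ∑ x, Φ x * Ψ x = (∑ x, Φ x) * ∑ x, Ψ x := by
    calc (Fintype.card G : ℂ) * ∑ x, Φ x * Ψ x = ∑ _y : G, ∑ x, Φ x * Ψ x := by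
          rw [Finset.sum_const, nsmul_eq_mul, Finset.card_univ]
      _ = ∑ y, ∑ x, Φ (x * y) * Ψ x := Finset.sum_congr rfl fun y _ => key y
      _ = ∑ x, (∑ y, Φ y) * Ψ x := by
          rw [Finset.sum_comm]
          refine Finset.sum_congr rfl fun x _ => ?_
          rw [← Finset.sum_mul]
          congr 1
          exact Fintype.sum_equiv (Equiv.mulLeft x) _ _ fun y => rfl
      _ = (∑ x, Φ x) * ∑ x, Ψ x := by rw [Finset.mul_sum]
  have hcard : (Fintype.card G : ℂ) ≠ 0 := Nat.cast_ne_zero.mpr Fintype.card_ne_zero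
  have hL : charInner (f₁ * g₁) (f₂ * g₂) = (Fintype.card G : ℂ)⁻¹ * ∑ x, Φ x * Ψ x := by
    rw [charInner]
    congr 1
    refine Finset.sum_congr rfl fun x _ => ?_
    simp only [Φ, Ψ, Pi.mul_apply, map_mul]
    ring
  rw [hL, charInner, charInner]
  change _ = (Fintype.card G : ℂ)⁻¹ * (∑ x, Φ x) * ((Fintype.card G : ℂ)⁻¹ * ∑ x, Ψ x)
  field_simp
  linear_combination hsum

end Factorization

/-! ### The block projection and the invariance of ξ_A -/

section Block

variable {n : ℕ} {F : Type*} [Field F]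

/-- The element of `U_n(F)` obtained from `g` by keeping only the entries in rows and columns
between `r` and `s`. -/
def blockElt (r s : Fin n) (g : U n F) : U n F :=
  ofMat (fun k l => if r ≤ k ∧ l ≤ s then mat g k l else (1 : Matrix (Fin n) (Fin n) F) k l)
    (fun i => by simp only [mat_diag, Matrix.one_apply_eq, ite_self])
    (fun i j h => by simp only [mat_lower g h, Matrix.one_apply_ne h.ne', ite_self])

lemma mat_blockElt (r s : Fin n) (g : U n F) (k l : Fin n) : mat (blockElt r s g) k l =
    if r ≤ k ∧ l ≤ s then mat g k l else (1 : Matrix (Fin n) (Fin n) F) k l := rfl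

/-- The projection of `U_n(F)` to the diagonal block with rows and columns between `r` and `s`. -/
def blockProj (r s : Fin n) : U n F →* U n F where
  toFun := blockElt r s
  map_one' := mat_injective (by
    ext k l
    rw [mat_blockElt, mat_one, ite_self])
  map_mul' g h := mat_injective (by
    ext k l
    rw [mat_mul, mat_blockElt, mat_mul, Matrix.mul_apply, Matrix.mul_apply]
    by_cases hk : r ≤ k
    · by_cases hl : l ≤ s
      · rw [if_pos ⟨hk, hl⟩]
        refine Finset.sum_congr rfl fun m _ => ?_
        rw [mat_blockElt, mat_blockElt]
        by_cases hm : k ≤ m ∧ m ≤ l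
        · rw [if_pos ⟨hk, hm.2.trans hl⟩, if_pos ⟨hk.trans hm.1, hl⟩]
        · rw [not_and_or, not_le, not_le] at hm
          rcases hm with hm | hm
          · rw [mat_lower g hm, Matrix.one_apply_ne hm.ne', ite_self, zero_mul, zero_mul]
          · rw [mat_lower h hm, Matrix.one_apply_ne hm.ne', ite_self, mul_zero, mul_zero]
      · rw [if_neg (fun h => hl h.2)]
        have : ∀ m, mat (blockElt r s h) m l = (1 : Matrix (Fin n) (Fin n) F) m l := fun m => by
          rw [mat_blockElt, if_neg (fun h => hl h.2)]
        simp only [this]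
        rw [← Matrix.mul_apply, Matrix.mul_one, mat_blockElt, if_neg (fun h => hl h.2)]
    · rw [if_neg (fun h => hk h.1)]
      have : ∀ m, mat (blockElt r s g) k m = (1 : Matrix (Fin n) (Fin n) F) k m := fun m => by
        rw [mat_blockElt, if_neg (fun h => hk h.1)]
      simp only [this]
      rw [← Matrix.mul_apply, Matrix.one_mul, mat_blockElt, if_neg (fun h => hk h.1)])

lemma mat_blockProj (r s : Fin n) (g : U n F) (k l : Fin n) : mat (blockProj r s g) k l =
    if r ≤ k ∧ l ≤ s then mat g k l else (1 : Matrix (Fin n) (Fin n) F) k l := rfl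

lemma blockProj_blockProj (r s : Fin n) (g : U n F) :
    blockProj r s (blockProj r s g) = blockProj r s g := by
  apply mat_injective
  ext k l
  rw [mat_blockProj, mat_blockProj]
  split_ifs <;> rfl

lemma mat_apply_of_blockProj_eq_one {r s : Fin n} {g : U n F} (h : blockProj r s g = 1)
    {k l : Fin n} (hk : r ≤ k) (hl : l ≤ s) : mat g k l = (1 : Matrix (Fin n) (Fin n) F) k l := by
  rw [← mat_one, ← h, mat_blockProj, if_pos ⟨hk, hl⟩]

lemma rootElt_one_ne_one (α : PosRoot n) : rootElt F α 1 ≠ 1 := by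
  intro h
  have := congrArg (fun g => mat g α.row α.col) h
  simp [mat_rootElt_apply, mat_one, Matrix.one_apply_ne α.lt.ne] at this

/-- The block projection fixes the generators of U_β, hence all of U_β, but it erases the entry of a
root outside the triangle. -/
lemma mem_triangle_of_rootElt_mem {α β : PosRoot n} (h : rootElt F α 1 ∈ triGroup F β) :
    α ∈ β.triangle := by
  have hP := iSup_X_induction (S := β.triangle) (P := fun g => blockProj β.row β.col g = g)
    ?_ (map_one _) (fun g h hg hh => by rw [map_mul, hg, hh]) h
  · by_contra hα
    have h1 : mat (blockProj β.row β.col (rootElt F α 1)) α.row α.col =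
        mat (rootElt F α 1) α.row α.col := by rw [hP]
    rw [mat_blockProj, if_neg (show ¬(β.row ≤ α.row ∧ α.col ≤ β.col) from hα), mat_rootElt_apply, Matrix.one_apply_ne α.lt.ne] at h1
    simp at h1
  · intro γ hγ c
    apply mat_injective
    ext k l
    rw [mat_blockProj]
    split_ifs with hkl
    · rfl
    · rw [mat_rootElt_apply, if_neg, add_zero]
      rintro ⟨rfl, rfl⟩
      exact hkl hγ

/-- A root whose hook group meets `U_β` trivially is in one of three positions relative to `β`. -/
lemma position_of_hookGroup_inf_triGroup {α β : PosRoot n}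
    (h : hookGroup F α ⊓ triGroup F β = ⊥) :
    α.col ≤ β.row ∨ β.col ≤ α.row ∨ (α.row < β.row ∧ β.col < α.col) := by
  have hdisj : ∀ γ ∈ α.hook, γ ∉ β.triangle := by
    intro γ hγ hγ'
    have hmem : rootElt F γ 1 ∈ hookGroup F α ⊓ triGroup F β :=
      ⟨le_biSup (X F) hγ (rootElt_mem_X γ 1), le_biSup (X F) hγ' (rootElt_mem_X γ 1)⟩
    rw [h, Subgroup.mem_bot] at hmem
    exact rootElt_one_ne_one γ hmem
  by_contra hcon
  push Not at hcon
  obtain ⟨h1, h2, h3⟩ := hcon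
  -- In any other position an explicit root of the hook lies in the triangle: one on the leg in row
  -- r, the corner α, or one on the arm in column s.
  by_cases hr : α.row < β.row
  · exact hdisj ⟨β.row, α.col, h1⟩ (Or.inr ⟨rfl, hr⟩) ⟨le_rfl, h3 hr⟩
  · rw [not_lt] at hr
    by_cases hc : α.col ≤ β.col
    · exact hdisj α (Or.inl (Or.inl rfl)) ⟨hr, hc⟩
    · rw [not_le] at hc
      exact hdisj ⟨α.row, β.col, h2⟩ (Or.inl (Or.inr ⟨rfl, hc⟩)) ⟨hr, le_rfl⟩

variable [Finite F]

/-- Row i of z⁻¹x starts at column i ≥ r, and in rows ≥ r and columns ≤ s the matrix y is the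
identity. Right multiplication by y thus preserves the row up to column j ≤ s, which is all that the
row function reads. -/
lemma elementaryChar_mul_of_blockProj_eq_one {β α : PosRoot n} (hα : α ∈ β.triangle)
    (l : LinChar F α) (x y : U n F) (hy : blockProj β.row β.col y = 1) :
    elementaryChar l (x * y) = elementaryChar l x := by
  rw [elementaryChar_apply, elementaryChar_apply]
  congr 1
  refine Finset.sum_congr rfl fun z _ => ?_
  rw [← mul_assoc, rowVec_mul]
  set w := rowVec (z⁻¹ * x) α.row with hw
  have hsplit : Matrix.vecMul w (mat y) = w + Matrix.vecMul w (mat y - 1) := by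
    rw [Matrix.vecMul_sub, Matrix.vecMul_one, add_sub_cancel]
  have hzero : ∀ k ≤ α.col, Matrix.vecMul w (mat y - 1) k = 0 := by
    intro k hk
    rw [Matrix.vecMul, dotProduct]
    refine Finset.sum_eq_zero fun m _ => ?_
    rcases lt_or_ge m α.row with h | h
    · rw [hw, rowVec, mat_lower _ h, zero_mul]
    · rw [Matrix.sub_apply, mat_apply_of_blockProj_eq_one hy (hα.1.trans h) (hk.trans hα.2),
        sub_self, mul_zero]
  rw [hsplit, rowFunAt_add _ _ _ _ (fun k hk => hzero k hk.le), hzero _ le_rfl, rootChar_zero,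
    one_mul]

lemma basicChar_mul_of_blockProj_eq_one {β : PosRoot n} {A : Finset (PosRoot n)}
    (hA : ∀ α ∈ A, α ∈ β.triangle) (φ : CharFamily F A) (x y : U n F)
    (hy : blockProj β.row β.col y = 1) : basicChar A φ (x * y) = basicChar A φ x := by
  simp only [basicChar, Finset.prod_apply]
  exact Finset.prod_congr rfl fun α _ =>
    elementaryChar_mul_of_blockProj_eq_one (hA α α.2) _ x y hy

end Block

/-! ### Replacing a block translation by elements of the kernel -/

section Absorption

variable {n : ℕ} {F : Type*} [Field F]

/-- The part of a matrix in rows before `r` and columns `r ≤ k < s`. -/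
def upperPart (r s : Fin n) (Y : Matrix (Fin n) (Fin n) F) : Matrix (Fin n) (Fin n) F :=
  fun a b => if a < r ∧ r ≤ b ∧ b < s then Y a b else 0

/-- The part of a matrix in rows `r ≤ k < s` and columns after `s`. -/
def rightPart (r s : Fin n) (d : Matrix (Fin n) (Fin n) F) : Matrix (Fin n) (Fin n) F :=
  fun a b => if (r ≤ a ∧ a < s) ∧ s < b then d a b else 0

/-- The strictly upper triangular part of the element `absorbElt`. -/
def absorbMat (r s : Fin n) (u Y d : Matrix (Fin n) (Fin n) F) : Matrix (Fin n) (Fin n) F :=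
  upperPart r s Y * u + rightPart r s d - upperPart r s Y * rightPart r s d

/-- The reason for the correction term -Y'd': the matrix d' then sees only the defect v - vY', so it
detects whether Y' reproduces v on the block columns. -/
lemma vecMul_absorbMat (r s : Fin n) (u Y d : Matrix (Fin n) (Fin n) F) (v : Fin n → F) :
    Matrix.vecMul v (absorbMat r s u Y d) =
      Matrix.vecMul (Matrix.vecMul v (upperPart r s Y)) u +
        Matrix.vecMul (v - Matrix.vecMul v (upperPart r s Y)) (rightPart r s d) := by
  rw [absorbMat, Matrix.vecMul_sub, Matrix.vecMul_add, Matrix.sub_vecMul, Matrix.vecMul_vecMul,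
    Matrix.vecMul_vecMul, add_sub_assoc]

lemma rightPart_eq_zero {r s : Fin n} (d : Matrix (Fin n) (Fin n) F) {a b : Fin n} (h : b ≤ s) :
    rightPart r s d a b = 0 := if_neg fun h' => absurd h (not_le.mpr h'.2)

lemma upperPart_eq_zero {r s : Fin n} (Y : Matrix (Fin n) (Fin n) F) {a b : Fin n} (h : r ≤ a) :
    upperPart r s Y a b = 0 := if_neg fun h' => absurd h (not_le.mpr h'.1)

lemma upperPart_mul_eq_zero {r s : Fin n} (Y M : Matrix (Fin n) (Fin n) F) {a b : Fin n}
    (h : r ≤ a) : (upperPart r s Y * M) a b = 0 := by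
  rw [Matrix.mul_apply]
  exact Finset.sum_eq_zero fun k _ => by rw [upperPart_eq_zero Y h, zero_mul]

/-- The first alternative makes 1 + `absorbMat` unitriangular, the second places it in the kernel of
the block projection. -/
lemma absorbMat_eq_zero {r s : Fin n} (hrs : r < s) {u : Matrix (Fin n) (Fin n) F}
    (hu : ∀ k l, l ≤ k → u k l = 0) (Y d : Matrix (Fin n) (Fin n) F) {a b : Fin n}
    (h : b ≤ a ∨ (r ≤ a ∧ b ≤ s)) : absorbMat r s u Y d a b = 0 := by
  rw [absorbMat, Matrix.sub_apply, Matrix.add_apply]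
  by_cases hra : r ≤ a
  · rw [upperPart_mul_eq_zero _ _ hra, upperPart_mul_eq_zero _ _ hra, zero_add, sub_zero]
    refine if_neg fun h' => ?_
    rcases h with h | h
    · exact absurd (h'.2.trans_le h) (not_lt.mpr h'.1.2.le)
    · exact absurd h'.2 (not_lt.mpr h.2)
  · have hba : b ≤ a := h.resolve_right fun h' => hra h'.1
    rw [not_le] at hra
    have hbs : b ≤ s := (hba.trans hra.le).trans hrs.le
    rw [rightPart_eq_zero d hbs, add_zero, Matrix.mul_apply, Matrix.mul_apply,
      Finset.sum_eq_zero, Finset.sum_eq_zero, sub_zero]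
    · exact fun k _ => by rw [rightPart_eq_zero d hbs, mul_zero]
    · intro k _
      by_cases hk : r ≤ k
      · rw [hu k b ((hba.trans hra.le).trans hk), mul_zero]
      · rw [upperPart, if_neg (fun h' => hk h'.2.1), zero_mul]

lemma mat_sub_one_eq_zero (t : U n F) (k l : Fin n) (h : l ≤ k) : (mat t - 1) k l = 0 := by
  rw [Matrix.sub_apply]
  rcases h.lt_or_eq with h | rfl
  · rw [mat_lower t h, Matrix.one_apply_ne h.ne', sub_zero]
  · rw [mat_diag, Matrix.one_apply_eq, sub_self]

/-- Elements with trivial block whose combinations act as `t` on suitable functions. -/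
def absorbElt {r s : Fin n} (hrs : r < s) (t : U n F)
    (p : Matrix (Fin n) (Fin n) F × Matrix (Fin n) (Fin n) F) : U n F :=
  ofMat (1 + absorbMat r s (mat t - 1) p.1 p.2)
    (fun i => by
      rw [Matrix.add_apply, absorbMat_eq_zero hrs (mat_sub_one_eq_zero t) _ _ (Or.inl le_rfl),
        add_zero, Matrix.one_apply_eq])
    (fun i j h => by
      rw [Matrix.add_apply, absorbMat_eq_zero hrs (mat_sub_one_eq_zero t) _ _ (Or.inl h.le),
        add_zero, Matrix.one_apply_ne h.ne'])

lemma mat_absorbElt {r s : Fin n} (hrs : r < s) (t : U n F)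
    (p : Matrix (Fin n) (Fin n) F × Matrix (Fin n) (Fin n) F) :
    mat (absorbElt hrs t p) = 1 + absorbMat r s (mat t - 1) p.1 p.2 := rfl

lemma blockProj_absorbElt {r s : Fin n} (hrs : r < s) (t : U n F)
    (p : Matrix (Fin n) (Fin n) F × Matrix (Fin n) (Fin n) F) :
    blockProj r s (absorbElt hrs t p) = 1 := by
  apply mat_injective
  ext k l
  rw [mat_blockProj, mat_one]
  split_ifs with h
  · rw [mat_absorbElt, Matrix.add_apply,
      absorbMat_eq_zero hrs (mat_sub_one_eq_zero t) _ _ (Or.inr h), add_zero]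
  · rfl

/-! ### The row functions -/

variable {ι : Type*} {r s : Fin n} {i j : ι → Fin n}

/-- The condition on `Y` under which `absorbElt` acts on the given rows as `t`. -/
def Matching (r s : Fin n) (i j : ι → Fin n) (v : ι → Fin n → F)
    (Y : Matrix (Fin n) (Fin n) F) : Prop :=
  ∀ α, i α < r → s < j α → ∀ k, r ≤ k → k < s → Matrix.vecMul (v α) (upperPart r s Y) k = v α k

lemma vecMul_upperPart_eq_zero {v : Fin n → F} (hv : ∀ k < r, v k = 0)
    (Y : Matrix (Fin n) (Fin n) F) : Matrix.vecMul v (upperPart r s Y) = 0 := by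
  funext k
  rw [Matrix.vecMul, dotProduct]
  refine Finset.sum_eq_zero fun a _ => ?_
  rcases lt_or_ge a r with h | h
  · rw [hv a h, zero_mul]
  · rw [upperPart_eq_zero Y h, mul_zero]

lemma vecMul_rightPart_of_le (v : Fin n → F) (d : Matrix (Fin n) (Fin n) F) {k : Fin n}
    (hk : k ≤ s) : Matrix.vecMul v (rightPart r s d) k = 0 := by
  rw [Matrix.vecMul, dotProduct]
  exact Finset.sum_eq_zero fun a _ => by rw [rightPart_eq_zero d hk, mul_zero]

lemma vecMul_rightPart_eq_zero {v : Fin n → F} (hv : ∀ k, r ≤ k → k < s → v k = 0)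
    (d : Matrix (Fin n) (Fin n) F) : Matrix.vecMul v (rightPart r s d) = 0 := by
  funext k
  rw [Matrix.vecMul, dotProduct]
  refine Finset.sum_eq_zero fun a _ => ?_
  by_cases h : r ≤ a ∧ a < s
  · rw [hv a h.1 h.2, zero_mul]
  · rw [rightPart, if_neg (fun h' => h h'.1), mul_zero]

/-- `u` is strictly upper triangular and supported in the block between `r` and `s`. -/
def IsBlockNilpotent (r s : Fin n) (u : Matrix (Fin n) (Fin n) F) : Prop :=
  ∀ k l, u k l ≠ 0 → r ≤ k ∧ k < l ∧ l ≤ s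

lemma IsBlockNilpotent.vecMul_eq {u : Matrix (Fin n) (Fin n) F} (hu : IsBlockNilpotent r s u)
    {v w : Fin n → F} (h : ∀ k, r ≤ k → k < s → v k = w k) :
    Matrix.vecMul v u = Matrix.vecMul w u := by
  funext l
  rw [Matrix.vecMul, Matrix.vecMul, dotProduct, dotProduct]
  refine Finset.sum_congr rfl fun k _ => ?_
  by_cases h0 : u k l = 0
  · rw [h0, mul_zero, mul_zero]
  · obtain ⟨h1, h2, h3⟩ := hu k l h0
    rw [h k h1 (h2.trans_le h3)]

lemma IsBlockNilpotent.vecMul_of_le {u : Matrix (Fin n) (Fin n) F} (hu : IsBlockNilpotent r s u)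
    (v : Fin n → F) {l : Fin n} (hl : l ≤ r) : Matrix.vecMul v u l = 0 := by
  rw [Matrix.vecMul, dotProduct]
  refine Finset.sum_eq_zero fun k _ => ?_
  by_cases h0 : u k l = 0
  · rw [h0, mul_zero]
  · obtain ⟨h1, h2, -⟩ := hu k l h0
    exact absurd (h1.trans_lt h2) (not_lt.mpr hl)

/-- Data of functions on rows which transform by additive characters `θ` under changes of the
entries in columns `≥ j`. -/
structure RowSystem (n : ℕ) (F : Type*) [Field F] (ι : Type*) (i j : ι → Fin n) where
  θ : ι → F → ℂ
  f : ι → (Fin n → F) → ℂ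
  v : ι → Fin n → F
  θ_zero : ∀ α, θ α 0 = 1
  exists_θ_ne_one : ∀ α, ∃ c, θ α c ≠ 1
  f_add : ∀ α w c, (∀ k < j α, c k = 0) → f α (w + c) = θ α (c (j α)) * f α w
  v_lower : ∀ α, ∀ k < i α, v α k = 0
  v_diag : ∀ α, v α (i α) = 1

namespace RowSystem

variable (R : RowSystem n F ι i j)

lemma f_add_of_le (α : ι) (w c : Fin n → F) (hc : ∀ k ≤ j α, c k = 0) :
    R.f α (w + c) = R.f α w := by
  rw [R.f_add α w c fun k hk => hc k hk.le, hc _ le_rfl, R.θ_zero, one_mul]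

/-- For j ≤ r the changes occur only in columns beyond j; for s ≤ i the row vanishes on the columns
that u and d' use; for i < r, s < j matching turns vY'u into vu and removes the d' term. -/
lemma f_of_matching (hrs : r < s)
    (hpos : ∀ α, j α ≤ r ∨ s ≤ i α ∨ (i α < r ∧ s < j α))
    {u : Matrix (Fin n) (Fin n) F} (hu : IsBlockNilpotent r s u)
    {Y : Matrix (Fin n) (Fin n) F} (hY : Matching r s i j R.v Y) (d : Matrix (Fin n) (Fin n) F)
    (α : ι) : R.f α (R.v α + Matrix.vecMul (R.v α) (absorbMat r s u Y d)) =
      R.f α (R.v α + Matrix.vecMul (R.v α) u) := by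
  rw [vecMul_absorbMat]
  rcases hpos α with h | h | ⟨h1, h2⟩
  · rw [R.f_add_of_le, R.f_add_of_le]
    · exact fun k hk => hu.vecMul_of_le _ (hk.trans h)
    · intro k hk
      rw [Pi.add_apply, hu.vecMul_of_le _ (hk.trans h),
        vecMul_rightPart_of_le _ _ ((hk.trans h).trans hrs.le), add_zero]
  · have hv : ∀ k < s, R.v α k = 0 := fun k hk => R.v_lower α k (hk.trans_le h)
    rw [vecMul_upperPart_eq_zero (fun k hk => hv k (hk.trans hrs)), sub_zero,
      vecMul_rightPart_eq_zero (fun k _ hk => hv k hk), add_zero,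
      hu.vecMul_eq (v := R.v α) (w := 0) (fun k _ hk => hv k hk)]
  · rw [hu.vecMul_eq (hY α h1 h2), vecMul_rightPart_eq_zero, add_zero]
    intro k hk hk'
    rw [Pi.sub_apply, hY α h1 h2 k hk hk', sub_self]

lemma rightPart_add_single {k l : Fin n} (hk : r ≤ k) (hk' : k < s) (hl : s < l)
    (d : Matrix (Fin n) (Fin n) F) (c : F) :
    rightPart r s (d + Matrix.single k l c) = rightPart r s d + Matrix.single k l c := by
  ext a b
  rw [Matrix.add_apply, rightPart, rightPart, Matrix.add_apply, Matrix.single_apply]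
  by_cases h : (r ≤ a ∧ a < s) ∧ s < b
  · rw [if_pos h, if_pos h]
  · rw [if_neg h, if_neg h, if_neg, add_zero]
    rintro ⟨rfl, rfl⟩
    exact h ⟨⟨hk, hk'⟩, hl⟩

lemma vecMul_single (w : Fin n → F) (k l : Fin n) (c : F) :
    Matrix.vecMul w (Matrix.single k l c) = Pi.single l (w k * c) := by
  funext m
  rw [Matrix.vecMul, dotProduct, Finset.sum_eq_single_of_mem k (Finset.mem_univ _),
    Matrix.single_apply, Pi.single_apply]
  · by_cases h : l = m
    · simp [h]
    · simp [h, Ne.symm h]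
  · intro b _ hb
    rw [Matrix.single_apply, if_neg (fun h => hb h.1.symm), mul_zero]

lemma sum_prod_of_not_matching [Fintype F] [Fintype ι] (hrs : r < s)
    (hj : Function.Injective j) (hpos : ∀ α, j α ≤ r ∨ s ≤ i α ∨ (i α < r ∧ s < j α))
    (u : Matrix (Fin n) (Fin n) F)
    {Y : Matrix (Fin n) (Fin n) F} (hY : ¬ Matching r s i j R.v Y) :
    ∑ d, ∏ α, R.f α (R.v α + Matrix.vecMul (R.v α) (absorbMat r s u Y d)) = 0 := by
  classical
  set w : ι → Fin n → F := fun α => R.v α - Matrix.vecMul (R.v α) (upperPart r s Y) with hw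
  let bad : Finset ι := Finset.univ.filter fun α =>
    i α < r ∧ s < j α ∧ ∃ k, r ≤ k ∧ k < s ∧ w α k ≠ 0
  have hbad : bad.Nonempty := by
    by_contra hne
    rw [Finset.not_nonempty_iff_eq_empty, Finset.filter_eq_empty_iff] at hne
    apply hY
    intro α h1 h2 k hk hk'
    by_contra h
    exact hne (Finset.mem_univ α) ⟨h1, h2, k, hk, hk', fun h0 => h (sub_eq_zero.mp h0).symm⟩
  -- Among the rows with a defect, take the one with the largest j. Changing d at (k₀, j α₀) is
  -- invisible to rows with smaller j, and rows with larger j have no defect at k₀. Only the factor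
  -- of α₀ changes, by θ(c₀) ≠ 1, so the sum over d is zero.
  obtain ⟨α₀, hα₀, hmax⟩ := Finset.exists_max_image bad j hbad
  simp only [bad, Finset.mem_filter, Finset.mem_univ, true_and] at hα₀ hmax
  obtain ⟨h1, h2, k₀, hk, hk', hne⟩ := hα₀
  obtain ⟨c₀, hc₀⟩ := R.exists_θ_ne_one α₀
  set c := (w α₀ k₀)⁻¹ * c₀ with hc
  have hstep : ∀ d α, Matrix.vecMul (R.v α) (absorbMat r s u Y (d + Matrix.single k₀ (j α₀) c)) =
      Matrix.vecMul (R.v α) (absorbMat r s u Y d) + Pi.single (j α₀) (w α k₀ * c) := by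
    intro d α
    rw [vecMul_absorbMat, vecMul_absorbMat, rightPart_add_single hk hk' h2, Matrix.vecMul_add,
      vecMul_single, ← add_assoc]
  have hfac : ∀ d α, R.f α (R.v α + Matrix.vecMul (R.v α)
      (absorbMat r s u Y (d + Matrix.single k₀ (j α₀) c))) = (if α = α₀ then R.θ α₀ c₀ else 1) *
        R.f α (R.v α + Matrix.vecMul (R.v α) (absorbMat r s u Y d)) := by
    intro d α
    rw [hstep, ← add_assoc]
    split_ifs with hα
    · subst hα
      rw [R.f_add, Pi.single_eq_same, hc, mul_inv_cancel_left₀ hne]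
      exact fun k hk => Pi.single_eq_of_ne hk.ne _
    · rw [one_mul]
      by_cases hlt : j α < j α₀
      · exact R.f_add_of_le _ _ _ fun k hk => Pi.single_eq_of_ne (hk.trans_lt hlt).ne _
      · have hw0 : w α k₀ = 0 := by
          have hgt : j α₀ < j α := lt_of_le_of_ne (not_lt.mp hlt) fun h => hα (hj h).symm
          rcases hpos α with h | h | ⟨h, h'⟩
          · exact absurd (h2.trans hgt) (not_lt.mpr (h.trans hrs.le))
          · have hv : ∀ k < s, R.v α k = 0 := fun k hk => R.v_lower α k (hk.trans_le h)
            simp only [hw, Pi.sub_apply]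
            rw [vecMul_upperPart_eq_zero (fun k hk => hv k (hk.trans hrs)), hv _ hk',
              Pi.zero_apply, sub_zero]
          · by_contra h0
            exact absurd (hmax α ⟨h, h', k₀, hk, hk', h0⟩) (not_le.mpr hgt)
        rw [hw0, zero_mul, Pi.single_zero, add_zero]
  set S := ∑ d, ∏ α, R.f α (R.v α + Matrix.vecMul (R.v α) (absorbMat r s u Y d)) with hS
  have hSS : S = R.θ α₀ c₀ * S := by
    conv_lhs => rw [hS, ← Fintype.sum_equiv (Equiv.addRight (Matrix.single k₀ (j α₀) c))
      (fun d => ∏ α, R.f α (R.v α + Matrix.vecMul (R.v α)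
        (absorbMat r s u Y (d + Matrix.single k₀ (j α₀) c)))) _ (fun d => rfl)]
    simp only [hfac, Finset.prod_mul_distrib, Finset.prod_ite_eq', Finset.mem_univ, if_true]
    rw [hS, Finset.mul_sum]
  have : (R.θ α₀ c₀ - 1) * S = 0 := by linear_combination -hSS
  exact (mul_eq_zero.mp this).resolve_left (sub_ne_zero.mpr hc₀)

/-- The number of matching matrices does not depend on the rows. -/
lemma card_matching (hi : Function.Injective i) :
    Nat.card {Y : Matrix (Fin n) (Fin n) F // Matching r s i j R.v Y} =
      Nat.card {Z : Matrix (Fin n) (Fin n) F //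
        ∀ α, i α < r → s < j α → ∀ k, r ≤ k → k < s → Z (i α) k = 0} := by
  classical
  let P : Fin n → Prop := fun a => ∃ α, i α = a ∧ i α < r ∧ s < j α
  -- The relevant rows, cut off at column r and completed by identity rows, form a unitriangular
  -- matrix g. Matching prescribes entries of gY, so Y ↦ gY - Z₀ turns it into a homogeneous
  -- condition free of the rows. Injectivity of `i` lets each row index recover its root.
  let M : Matrix (Fin n) (Fin n) F := fun a k =>
    if h : P a then (if k < r then R.v h.choose k else 0) else (1 : Matrix _ _ F) a k
  have hM : ∀ α, i α < r → s < j α → ∀ k, M (i α) k = if k < r then R.v α k else 0 := by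
    intro α h1 h2 k
    have h : P (i α) := ⟨α, rfl, h1, h2⟩
    have hα : h.choose = α := hi h.choose_spec.1
    simp only [M, dif_pos h, hα]
  let g : U n F := ofMat M
    (fun a => by
      by_cases h : P a
      · obtain ⟨α, rfl, h1, h2⟩ := h
        rw [hM α h1 h2, if_pos h1, R.v_diag]
      · simp only [M, dif_neg h, Matrix.one_apply_eq])
    (fun a k hk => by
      by_cases h : P a
      · obtain ⟨α, rfl, h1, h2⟩ := h
        rw [hM α h1 h2, R.v_lower α k hk, ite_self]
      · simp only [M, dif_neg h, Matrix.one_apply_ne hk.ne'])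
  let Z₀ : Matrix (Fin n) (Fin n) F := fun a k => if h : P a then R.v h.choose k else 0
  have hZ₀ : ∀ α, i α < r → s < j α → ∀ k, Z₀ (i α) k = R.v α k := by
    intro α h1 h2 k
    have h : P (i α) := ⟨α, rfl, h1, h2⟩
    have hα : h.choose = α := hi h.choose_spec.1
    simp only [Z₀, dif_pos h, hα]
  let e : Matrix (Fin n) (Fin n) F ≃ Matrix (Fin n) (Fin n) F :=
    { toFun := fun Y => mat g * Y - Z₀
      invFun := fun Z => mat g⁻¹ * (Z + Z₀)
      left_inv := fun Y => by
        beta_reduce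
        rw [sub_add_cancel, ← Matrix.mul_assoc, mat_inv_mul_mat, Matrix.one_mul]
      right_inv := fun Z => by
        beta_reduce
        rw [← Matrix.mul_assoc, mat_mul_mat_inv, Matrix.one_mul, add_sub_cancel_right] }
  refine Nat.card_congr (e.subtypeEquiv fun Y => ?_)
  refine forall_congr' fun α => forall_congr' fun h1 => forall_congr' fun h2 =>
    forall_congr' fun k => forall_congr' fun hk => forall_congr' fun hk' => ?_
  have : (mat g * Y) (i α) k = Matrix.vecMul (R.v α) (upperPart r s Y) k := by
    rw [Matrix.mul_apply, Matrix.vecMul, dotProduct]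
    refine Finset.sum_congr rfl fun a _ => ?_
    rw [show mat g (i α) a = _ from hM α h1 h2 a, upperPart]
    by_cases ha : a < r
    · rw [if_pos ha, if_pos ⟨ha, hk, hk'⟩]
    · rw [if_neg ha, if_neg (fun h => ha h.1), zero_mul, mul_zero]
  change _ ↔ (mat g * Y - Z₀) (i α) k = 0
  rw [Matrix.sub_apply, this, hZ₀ α h1 h2, sub_eq_zero]

lemma sum_prod [Fintype F] [Fintype ι] (hrs : r < s) (hi : Function.Injective i)
    (hj : Function.Injective j) (hpos : ∀ α, j α ≤ r ∨ s ≤ i α ∨ (i α < r ∧ s < j α))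
    {u : Matrix (Fin n) (Fin n) F} (hu : IsBlockNilpotent r s u) :
    ∑ p : Matrix (Fin n) (Fin n) F × Matrix (Fin n) (Fin n) F,
        ∏ α, R.f α (R.v α + Matrix.vecMul (R.v α) (absorbMat r s u p.1 p.2)) =
      (Nat.card {Z : Matrix (Fin n) (Fin n) F //
        ∀ α, i α < r → s < j α → ∀ k, r ≤ k → k < s → Z (i α) k = 0} *
          Nat.card (Matrix (Fin n) (Fin n) F) : ℂ) *
        ∏ α, R.f α (R.v α + Matrix.vecMul (R.v α) u) := by
  classical
  rw [Fintype.sum_prod_type, ← R.card_matching hi, Nat.card_eq_fintype_card,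
    Fintype.card_subtype, Nat.card_eq_fintype_card]
  have : ∀ Y : Matrix (Fin n) (Fin n) F,
      ∑ d, ∏ α, R.f α (R.v α + Matrix.vecMul (R.v α) (absorbMat r s u Y d)) =
      if Matching r s i j R.v Y then (Fintype.card (Matrix (Fin n) (Fin n) F) : ℂ) *
        ∏ α, R.f α (R.v α + Matrix.vecMul (R.v α) u) else 0 := by
    intro Y
    split_ifs with hY
    · simp only [R.f_of_matching hrs hpos hu hY]
      rw [Finset.sum_const, nsmul_eq_mul, Finset.card_univ]
    · exact R.sum_prod_of_not_matching hrs hj hpos u hY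
  simp only [this]
  rw [← Finset.sum_filter, Finset.sum_const, nsmul_eq_mul, mul_assoc]

end RowSystem

end Absorption

/-! ### Basic characters and the absorption property of ξ_B -/

section BasicCharacters

variable {n : ℕ} {F : Type*} [Field F]

lemma isBlockNilpotent_blockProj (r s : Fin n) (t : U n F) :
    IsBlockNilpotent r s (mat (blockProj r s t) - 1) := by
  intro k l h
  have hkl : k < l := by
    by_contra hkl
    exact h (mat_sub_one_eq_zero _ k l (not_lt.mp hkl))
  by_contra hcon
  apply h
  rw [Matrix.sub_apply, mat_blockProj, if_neg (fun h' => hcon ⟨h'.1, hkl, h'.2⟩), sub_self]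

lemma rowVec_mul_eq_add (g h : U n F) (a : Fin n) :
    rowVec (g * h) a = rowVec g a + Matrix.vecMul (rowVec g a) (mat h - 1) := by
  rw [rowVec_mul, Matrix.vecMul_sub, Matrix.vecMul_one, add_sub_cancel]

/-- The row system attached to a family of linear characters and group elements. -/
def rowSystem {B : Finset (PosRoot n)} (φ : CharFamily F B) (g : B → U n F) (z : B → U n F) :
    RowSystem n F B (fun α => α.1.row) (fun α => α.1.col) where
  θ α := rootChar (φ α)
  f α := rowFunAt (φ α) (z α)
  v α := rowVec (g α) α.1.row
  θ_zero α := rootChar_zero (φ α)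
  exists_θ_ne_one α := exists_rootChar_ne_one (φ α)
  f_add α w c hc := rowFunAt_add (φ α) (z α) w c hc
  v_lower α _ hk := mat_lower (g α) hk
  v_diag α := mat_diag (g α) α.1.row

variable [Fintype F]

open scoped Classical in
lemma basicChar_apply (B : Finset (PosRoot n)) (φ : CharFamily F B) (g : U n F) :
    basicChar B φ g = (∏ α : B, (Nat.card (baseGroup F α.1) : ℂ)⁻¹) *
      ∑ z : B → U n F, ∏ α : B, rowFunAt (φ α) (z α) (rowVec ((z α)⁻¹ * g) α.1.row) := by
  simp only [basicChar, Finset.prod_apply, elementaryChar_apply, Finset.prod_mul_distrib]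
  rw [Finset.prod_univ_sum, Fintype.piFinset_univ]

/-- If the roots of `B` lie in different rows and columns, and none of their hooks meets the
triangle of `β`, then translations by elements of `U_β` are absorbed in `ξ_{B,φ}`. -/
lemma exists_absorbsTranslation {B : Finset (PosRoot n)} (β : PosRoot n)
    (hB : ∀ α ∈ B, ∀ γ ∈ B, α ≠ γ → α.Separate γ)
    (hpos : ∀ α ∈ B, α.col ≤ β.row ∨ β.col ≤ α.row ∨ (α.row < β.row ∧ β.col < α.col))
    (φ : CharFamily F B) :
    ∃ κ : ℂ, ∀ t, AbsorbsTranslation κ (absorbElt β.lt (blockProj β.row β.col t))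
      (blockProj β.row β.col t) (basicChar B φ) := by
  classical
  have hi : Function.Injective fun α : B => α.1.row := fun α γ h => by
    by_contra hne
    exact (hB α α.2 γ γ.2 (fun h' => hne (Subtype.ext h'))).1 h
  have hj : Function.Injective fun α : B => α.1.col := fun α γ h => by
    by_contra hne
    exact (hB α α.2 γ γ.2 (fun h' => hne (Subtype.ext h'))).2 h
  set C : ℂ := Nat.card {Z : Matrix (Fin n) (Fin n) F // ∀ α : B, α.1.row < β.row →
    β.col < α.1.col → ∀ k, β.row ≤ k → k < β.col → Z α.1.row k = 0} *
      Nat.card (Matrix (Fin n) (Fin n) F) with hC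
  have hC0 : C ≠ 0 := by
    have : Nonempty {Z : Matrix (Fin n) (Fin n) F // ∀ α : B, α.1.row < β.row →
      β.col < α.1.col → ∀ k, β.row ≤ k → k < β.col → Z α.1.row k = 0} :=
      ⟨⟨0, fun _ _ _ _ _ _ => rfl⟩⟩
    exact mul_ne_zero (Nat.cast_ne_zero.mpr Nat.card_pos.ne')
      (Nat.cast_ne_zero.mpr Nat.card_pos.ne')
  refine ⟨C⁻¹, fun t x => ?_⟩
  rw [eq_inv_mul_iff_mul_eq₀ hC0]
  simp only [basicChar_apply]
  rw [← Finset.mul_sum, mul_left_comm]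
  congr 1
  -- The conjugating elements z are fixed on both sides, so the identity holds term by term; this is
  -- where independence of the constant from the rows is needed.
  rw [Finset.sum_comm, Finset.mul_sum]
  refine Finset.sum_congr rfl fun z _ => ?_
  have := (rowSystem φ (fun α => (z α)⁻¹ * x) z).sum_prod β.lt hi hj (fun α => hpos α α.2)
    (isBlockNilpotent_blockProj β.row β.col t)
  simp only [rowSystem] at this
  simp only [← mul_assoc, rowVec_mul_eq_add _ (blockProj _ _ _), rowVec_mul_eq_add _ (absorbElt _ _ _),
    mat_absorbElt, add_sub_cancel_left]
  exact this.symm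

lemma basicChar_union {D A B : Finset (PosRoot n)} (hdisj : Disjoint A B)
    (hD : ∀ α, α ∈ D ↔ α ∈ A ∨ α ∈ B) {φ : CharFamily F D} {φA : CharFamily F A}
    {φB : CharFamily F B} (hφ : IsUnionFamily φ φA φB) :
    basicChar D φ = basicChar A φA * basicChar B φB := by
  classical
  let e : A ⊕ B ≃ D := Equiv.ofBijective
    (Sum.elim (fun α => ⟨α.1, (hD _).mpr (Or.inl α.2)⟩) fun α => ⟨α.1, (hD _).mpr (Or.inr α.2)⟩)
    ⟨by
      rintro (⟨a, ha⟩ | ⟨a, ha⟩) (⟨b, hb⟩ | ⟨b, hb⟩) h <;>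
        simp only [Sum.elim_inl, Sum.elim_inr, Subtype.mk.injEq] at h <;> subst h
      · rfl
      · exact absurd hb (Finset.disjoint_left.mp hdisj ha)
      · exact absurd ha (Finset.disjoint_left.mp hdisj hb)
      · rfl, by
      rintro ⟨a, ha⟩
      rcases (hD a).mp ha with h | h
      · exact ⟨Sum.inl ⟨a, h⟩, rfl⟩
      · exact ⟨Sum.inr ⟨a, h⟩, rfl⟩⟩
  rw [basicChar, ← Fintype.prod_equiv e (fun x => elementaryChar (φ (e x))) _ (fun x => rfl),
    Fintype.prod_sum_type]
  congr 1
  · exact Finset.prod_congr rfl fun α _ => congrArg elementaryChar (hφ.1 α.1 _ α.2)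
  · exact Finset.prod_congr rfl fun α _ => congrArg elementaryChar (hφ.2 α.1 _ α.2)

end BasicCharacters

/-! ### Constituents of a product of class functions -/

section Constituents

variable {G : Type*} [Group G] [Fintype G]

/-- Expanding ξ and η writes ξη as a combination of irreducible products χ₁χ₂; an irreducible χ
different from all of them is orthogonal to ξη. -/
lemma exists_mul_eq_of_mem_constituents_mul {ξ η χ : G → ℂ} (hξ : IsClassFun ξ)
    (hη : IsClassFun η) (hχ : χ ∈ constituents (ξ * η))
    (hirr : ∀ χ₁ ∈ constituents ξ, ∀ χ₂ ∈ constituents η, χ₁ * χ₂ ∈ IrrChar G) :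
    ∃ χ₁ ∈ constituents ξ, ∃ χ₂ ∈ constituents η, χ = χ₁ * χ₂ := by
  classical
  by_contra hcon
  push Not at hcon
  apply hχ.2
  have hmem : ∀ {ζ : G → ℂ} {ψ : G → ℂ}, ψ ∈ irrChar_finite.toFinset → charInner ζ ψ ≠ 0 →
      ψ ∈ constituents ζ := fun {ζ ψ} h h' =>
    ⟨irrChar_finite.mem_toFinset.mp h, fun h0 => h' (by
      rw [← charInner_star_symm, h0, map_zero])⟩
  have hexp : ξ * η = ∑ p ∈ irrChar_finite.toFinset ×ˢ irrChar_finite.toFinset,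
      (charInner ξ p.1 * charInner η p.2) • (p.1 * p.2 : G → ℂ) := by
    conv_lhs => rw [eq_sum_charInner_smul hξ, eq_sum_charInner_smul hη]
    rw [Finset.sum_mul_sum, ← Finset.sum_product']
    exact Finset.sum_congr rfl fun p _ => smul_mul_smul_comm _ _ _ _
  rw [← charInner_star_symm, hexp, charInner_sum_left, Finset.sum_eq_zero, map_zero]
  rintro ⟨ψ₁, ψ₂⟩ hp
  rw [Finset.mem_product] at hp
  by_cases h1 : charInner ξ ψ₁ = 0
  · rw [h1, zero_mul, zero_mul]
  by_cases h2 : charInner η ψ₂ = 0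
  · rw [h2, mul_zero, zero_mul]
  have hc1 := hmem hp.1 h1
  have hc2 := hmem hp.2 h2
  rw [charInner_irrChar (hirr _ hc1 _ hc2) hχ.1, if_neg (hcon _ hc1 _ hc2).symm, mul_zero]

end Constituents

end UTri

end

/-! ### The decomposition theorem -/

theorem lemma3p6 {F : Type*} [Field F] [Finite F] {n : ℕ}
    (D A B : Finset (UTri.PosRoot n))
    (hD : UTri.IsBasic D) (hAB : UTri.DecomposesAs F D A B)
    (φ : UTri.CharFamily F D) (φA : UTri.CharFamily F A) (φB : UTri.CharFamily F B)
    (hφ : UTri.IsUnionFamily φ φA φB) :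
    (∀ χA ∈ UTri.constituents (UTri.basicChar A φA),
      ∀ χB ∈ UTri.constituents (UTri.basicChar B φB),
        χA * χB ∈ UTri.constituents (UTri.basicChar D φ)) ∧
    (∀ χ ∈ UTri.constituents (UTri.basicChar D φ),
      ∃! p : (UTri.U n F → ℂ) × (UTri.U n F → ℂ),
        p.1 ∈ UTri.constituents (UTri.basicChar A φA) ∧
        p.2 ∈ UTri.constituents (UTri.basicChar B φB) ∧ χ = p.1 * p.2) ∧
    (UTri.constituents (UTri.basicChar D φ)).encard =
      (UTri.constituents (UTri.basicChar A φA) ×ˢ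
        UTri.constituents (UTri.basicChar B φB)).encard := by
  classical
  have : Fintype F := Fintype.ofFinite F
  obtain ⟨-, -, hdisj, hmem, β, hA, hB⟩ := hAB
  have hAtri : ∀ α ∈ A, α ∈ β.triangle := fun α hα =>
    UTri.mem_triangle_of_rootElt_mem (hA (le_biSup (UTri.triGroup F) hα
      (le_biSup (UTri.X F) (show α ∈ α.triangle from ⟨le_rfl, le_rfl⟩)
        (UTri.rootElt_mem_X α 1))))
  have hBpos : ∀ α ∈ B, α.col ≤ β.row ∨ β.col ≤ α.row ∨ (α.row < β.row ∧ β.col < α.col) :=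
    fun α hα => UTri.position_of_hookGroup_inf_triGroup (F := F) (eq_bot_iff.mpr
      ((inf_le_inf_right _ (le_biSup (UTri.hookGroup F) hα)).trans hB.le))
  have hBsep : ∀ α ∈ B, ∀ γ ∈ B, α ≠ γ → α.Separate γ := fun α hα γ hγ =>
    hD.2 α ((hmem α).mpr (Or.inr hα)) γ ((hmem γ).mpr (Or.inr hγ))
  obtain ⟨κ, hκ⟩ := UTri.exists_absorbsTranslation β hBsep hBpos φB
  have hclA := UTri.isClassFun_basicChar A φA
  have hclB := UTri.isClassFun_basicChar B φB
  have hinv := UTri.basicChar_mul_of_blockProj_eq_one hAtri φA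
  have hfac := fun (f₁ f₂ g₁ g₂ : UTri.U n F → ℂ) =>
    UTri.charInner_mul_mul (π := UTri.blockProj β.row β.col)
      (UTri.blockProj_blockProj β.row β.col) (κ := κ)
      (q := fun t => UTri.absorbElt β.lt (UTri.blockProj β.row β.col t))
      (fun t => UTri.blockProj_absorbElt β.lt _) (f₁ := f₁) (f₂ := f₂) (g₁ := g₁) (g₂ := g₂)
  have hinvA : ∀ χ ∈ UTri.constituents (UTri.basicChar A φA), ∀ x y,
      UTri.blockProj β.row β.col y = 1 → χ (x * y) = χ x := fun χ hχ x y hy =>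
    UTri.invariant_of_mem_constituents (fun x => hinv x y hy) hclA hχ x
  have habsB : ∀ χ ∈ UTri.constituents (UTri.basicChar B φB), ∀ t,
      UTri.AbsorbsTranslation κ (UTri.absorbElt β.lt (UTri.blockProj β.row β.col t))
        (UTri.blockProj β.row β.col t) χ := fun χ hχ t =>
    (hκ t).of_mem_constituents hclB hχ
  have hprod : ∀ χA ∈ UTri.constituents (UTri.basicChar A φA),
      ∀ χB ∈ UTri.constituents (UTri.basicChar B φB),
      ∀ ψA ∈ UTri.constituents (UTri.basicChar A φA),
      ∀ ψB ∈ UTri.constituents (UTri.basicChar B φB),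
      UTri.charInner (χA * χB) (ψA * ψB) =
        (if χA = ψA then 1 else 0) * if χB = ψB then 1 else 0 := by
    intro χA hχA χB hχB ψA hψA ψB hψB
    rw [hfac _ _ _ _ (hinvA _ hχA) (hinvA _ hψA) (habsB _ hχB) (habsB _ hψB) hψB.1,
      UTri.charInner_irrChar hχA.1 hψA.1, UTri.charInner_irrChar hχB.1 hψB.1]
  have hirr : ∀ χA ∈ UTri.constituents (UTri.basicChar A φA),
      ∀ χB ∈ UTri.constituents (UTri.basicChar B φB), χA * χB ∈ UTri.IrrChar (UTri.U n F) := by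
    intro χA hχA χB hχB
    apply UTri.mul_mem_irrChar hχA.1 hχB.1
    rw [hprod _ hχA _ hχB _ hχA _ hχB, if_pos rfl, if_pos rfl, one_mul]
  have hinj : ∀ χA ∈ UTri.constituents (UTri.basicChar A φA),
      ∀ χB ∈ UTri.constituents (UTri.basicChar B φB),
      ∀ ψA ∈ UTri.constituents (UTri.basicChar A φA),
      ∀ ψB ∈ UTri.constituents (UTri.basicChar B φB), χA * χB = ψA * ψB →
      χA = ψA ∧ χB = ψB := by
    intro χA hχA χB hχB ψA hψA ψB hψB h
    have h1 := hprod _ hχA _ hχB _ hψA _ hψB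
    rw [← h, UTri.charInner_irrChar (hirr _ hχA _ hχB) (hirr _ hχA _ hχB), if_pos rfl] at h1
    by_contra hcon
    rw [not_and_or] at hcon
    rcases hcon with hcon | hcon <;> simp [hcon] at h1
  have hmul : ∀ χA ∈ UTri.constituents (UTri.basicChar A φA),
      ∀ χB ∈ UTri.constituents (UTri.basicChar B φB),
        χA * χB ∈ UTri.constituents (UTri.basicChar D φ) := by
    intro χA hχA χB hχB
    refine ⟨hirr _ hχA _ hχB, fun h0 => ?_⟩
    -- The factorization is applied to ξ_A, ξ_B against χ_A, χ_B; irreducibility is needed only for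
    -- the second B-factor, so ξ_B itself is allowed.
    rw [UTri.basicChar_union hdisj hmem hφ, ← UTri.charInner_star_symm, map_eq_zero,
      hfac _ _ _ _ hinv (hinvA _ hχA) hκ (habsB _ hχB) hχB.1, mul_eq_zero] at h0
    rcases h0 with h0 | h0
    · exact hχA.2 (by rw [← UTri.charInner_star_symm, h0, map_zero])
    · exact hχB.2 (by rw [← UTri.charInner_star_symm, h0, map_zero])
  have hexists : ∀ χ ∈ UTri.constituents (UTri.basicChar D φ),
      ∃ χA ∈ UTri.constituents (UTri.basicChar A φA),
        ∃ χB ∈ UTri.constituents (UTri.basicChar B φB), χ = χA * χB := by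
    intro χ hχ
    rw [UTri.basicChar_union hdisj hmem hφ] at hχ
    exact UTri.exists_mul_eq_of_mem_constituents_mul hclA hclB hχ hirr
  refine ⟨hmul, fun χ hχ => ?_, ?_⟩
  · obtain ⟨χA, hχA, χB, hχB, rfl⟩ := hexists χ hχ
    refine ⟨(χA, χB), ⟨hχA, hχB, rfl⟩, ?_⟩
    rintro ⟨ψA, ψB⟩ ⟨hψA, hψB, h⟩
    obtain ⟨h1, h2⟩ := hinj _ hχA _ hχB _ hψA _ hψB h
    rw [h1, h2]
  · rw [← Set.InjOn.encard_image (f := fun p : (UTri.U n F → ℂ) × (UTri.U n F → ℂ) => p.1 * p.2)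
      (s := UTri.constituents (UTri.basicChar A φA) ×ˢ UTri.constituents (UTri.basicChar B φB))]
    · congr 1
      ext χ
      constructor
      · intro hχ
        obtain ⟨χA, hχA, χB, hχB, rfl⟩ := hexists χ hχ
        exact ⟨(χA, χB), ⟨hχA, hχB⟩, rfl⟩
      · rintro ⟨⟨χA, χB⟩, ⟨hχA, hχB⟩, rfl⟩
        exact hmul _ hχA _ hχB
    · rintro ⟨χA, χB⟩ ⟨hχA, hχB⟩ ⟨ψA, ψB⟩ ⟨hψA, hψB⟩ h
      obtain ⟨h1, h2⟩ := hinj _ hχA _ hχB _ hψA _ hψB h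
      exact Prod.ext h1 h2
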